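/- For integers $d,n\ge 1$ let the Hamming torus be the graph on $[n]^d$ in which two vertices are adjacent when they differ in exactly one coordinate. For $S\subset[n]^d$ let $\langle S\rangle$ be the set of vertices eventually open in bootstrap percolation with threshold $2$ started from $S$: at each step open vertices stay open, and a closed vertex becomes open if at least $2$ of its neighbours are open. A subtorus of dimension $i$ is a set of the form $V=\{v\in[n]^d : v_l=\alpha_l \text{ for all } l\in I\}$, where $I$ is a set of $d-i$ coordinates and the $\alpha_l\in[n]$ are constants. Let the initial configuration $\omega_0\subset[n]^d$ contain each vertex independently with probability $p$, write $\mathbb{P}_p$ for its law, and let $\mathcal{I}_i$ be the event that there is a subtorus $V$ of dimension $i$ with $V=\langle\omega_0\cap V\rangle$ (that is, $V$ is internally spanned by $\omega_0$). **Theorem.** Fix an integer $J\ge 1$ and a real number $a>0$, and let $$d=(J+1)(J+2),\qquad p=p(n)=a\,n^{-2J-2},\qquad \lambda_J=\binom{d}{2J}(2J)!\,2^{-J-1}a^{J+1}.$$ There exist constants $0<c_1<c_2<1-e^{-\lambda_J}$, depending only on $J$ and $a$, such that for all large enough $n$ $$\mathbb{P}_p(\mathcal{I}_{2J}\setminus\mathcal{I}_{2J+2})>c_1\qquad\text{and}\qquad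 \mathbb{P}_p(\mathcal{I}_{2J+2})>c_2 .$$ Moreover, $$\mathbb{P}_p(\mathcal{I}_{2J+2}\setminus\mathcal{I}_{d})\to 0\qquad\text{as } n\to\infty .$$ -/

import Mathlib

open MeasureTheory ProbabilityTheory Filter Topology

noncomputable section

/-- One step of bootstrap percolation with threshold `θ` on the graph `G`. A configuration is
identified with its set of open vertices: an open vertex stays open, and a closed vertex opens if
at least `θ` of its neighbours are open. -/
def bootstrapStep {V : Type*} (G : SimpleGraph V) (θ : ℕ) (S : Set V) : Set V :=
  {v | v ∈ S ∨ (θ : ℕ∞) ≤ (G.neighborSet v ∩ S).encard}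

/-- The span of `S`: the set of vertices that are eventually open when the process starts
from `S`. -/
def bootstrapSpan {V : Type*} (G : SimpleGraph V) (θ : ℕ) (S : Set V) : Set V :=
  ⋃ t : ℕ, (bootstrapStep G θ)^[t] S

/-- The `d`-dimensional Hamming torus on `[n]^d`: two vertices are adjacent when they differ in
exactly one coordinate. -/
def hammingTorus (d n : ℕ) : SimpleGraph (Fin d → Fin n) where
  Adj v w := hammingDist v w = 1
  symm := ⟨fun v w h => by rw [hammingDist_comm]; exact h⟩
  loopless := ⟨fun v h => by simp at h⟩

/-- `V` is a subtorus of `[n]^d` of dimension `i`: it is cut out by fixing the coordinates in a set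
`I` of `d - i` indices. -/
def IsSubtorus (d n i : ℕ) (V : Set (Fin d → Fin n)) : Prop :=
  ∃ (I : Finset (Fin d)) (α : Fin d → Fin n), I.card + i = d ∧
    ∀ v : Fin d → Fin n, v ∈ V ↔ ∀ l ∈ I, v l = α l

/-- `S` internally spans `V` in the Hamming torus, with threshold `2`. -/
def InternallySpans {d n : ℕ} (S V : Set (Fin d → Fin n)) : Prop :=
  V = bootstrapSpan (hammingTorus d n) 2 (S ∩ V)

/-- The event that the initial configuration internally spans some `i`-dimensional subtorus. -/
def eventI (d n i : ℕ) : Set (Set (Fin d → Fin n)) :=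
  {ω₀ | ∃ V, IsSubtorus d n i V ∧ InternallySpans ω₀ V}

/-- The law of the initial configuration on `[n]^d`: every vertex is open with probability `p`,
independently. A real number `p` outside `[0, 1]` is replaced by the nearest end point. -/
def initialLaw (d n : ℕ) (p : ℝ) : Measure (Set (Fin d → Fin n)) :=
  setBernoulli Set.univ (Set.projIcc (0 : ℝ) 1 zero_le_one p)

/-- `λ(j, d, a) = (d choose 2j) (2j)! 2^(-j-1) a^(j+1)`. -/
def lambdaParam (j d : ℕ) (a : ℝ) : ℝ :=
  (d.choose (2 * j) : ℝ) * ((2 * j).factorial : ℝ) * (2 : ℝ) ^ (-(j : ℤ) - 1) * a ^ (j + 1)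

end

/-! A subtorus of dimension `2j` is spanned most cheaply by starting from one open vertex and
repeatedly adding an open vertex at distance two from the current subtorus. Going from `2j` to `2j +
2` multiplies the probability by `n ^ 2` (positions of the smaller subtorus) and by `n ^ (2j + 2) *
p` (positions of the new vertex). With `f = costExponent J`, a given subtorus of even dimension `i ≤
2J + 2` is thus spanned with probability of order `n ^ (-f i)`. For `d = (J + 1) * (J + 2)` one has
`f i = d - i` both at `i = 2J` and at `i = 2J + 2`, so at both levels the expected number of spanned
subtori is of order one. The two levels agree because `n ^ (2J + 2) * p = a`: a spanned subtorus of
dimension `2J` grows further with a probability of order one.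

Upper bounds (`exists_assemblyWeight_le`) come from a union bound over the last merger. Lower bounds
(`exists_le_spanEvent_real`) use parallel subtori, which are disjoint and hence independent; this
gives `exists_le_eventI_real`. To avoid dimension `2J + 2`, one asks that some `V` of dimension `2J`
be spanned while no "blocker" outside `V` is open. Blockers are independent of the inside of `V`,
their expected number is bounded (`exists_sum_blockers_le`), and Harris' inequality bounds the
probability of having none from below. For parallel `V` these events are mutually exclusive, so
their probabilities add up (`exists_le_eventI_diff_real`).

Finally, a spanned subtorus of dimension `2J + 2` has `a * (n - 1)` open vertices on average at
distance one in each fixed direction. It fails to grow to the whole torus with exponentially small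
probability (`exists_eventI_diff_real_le`). -/

/-! ### Product measure: independence, Harris' inequality, exponential bounds -/

section SetBernoulli
open unitInterval
variable {V : Type*} {p : I}

/-- The event `E` depends only on the configuration inside `A`. -/
def DeterminedBy (A : Set V) (E : Set (Set V)) : Prop :=
  ∀ ω ω' : Set V, (∀ v ∈ A, v ∈ ω ↔ v ∈ ω') → (ω ∈ E ↔ ω' ∈ E)

theorem DeterminedBy.compl {A : Set V} {E : Set (Set V)} (h : DeterminedBy A E) :
    DeterminedBy A Eᶜ := fun ω ω' hω => not_congr (h ω ω' hω)

theorem DeterminedBy.iInter {ι : Type*} {s : Set ι} {A : ι → Set V} {E : ι → Set (Set V)}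
    (hE : ∀ i ∈ s, DeterminedBy (A i) (E i)) :
    DeterminedBy (⋃ i ∈ s, A i) (⋂ i ∈ s, E i) := fun ω ω' hω => by
  simp only [Set.mem_iInter]
  exact forall₂_congr fun i hi => hE i hi ω ω' fun v hv => hω v (Set.mem_biUnion hi hv)

theorem setBernoulli_real_superset (B : Finset V) :
    (setBernoulli Set.univ p).real {ω | (B : Set V) ⊆ ω} = (p : ℝ) ^ B.card := by
  rw [measureReal_def, setBernoulli_apply']
  have h : ((fun q : V → Prop => {i | q i}) ⁻¹' {ω | (B : Set V) ⊆ ω}) =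
      (B : Set V).pi fun _ => {True} := by
    ext q
    simp [Set.subset_def, Set.mem_pi]
  rw [h, Measure.infinitePi_pi _ (fun _ _ => MeasurableSet.of_discrete)]
  simp [Finset.prod_const]

theorem isLowerSet_not_superset (B : Set V) : IsLowerSet {ω : Set V | ¬ B ⊆ ω} :=
  fun _ _ hst hs ht => hs (ht.trans hst)

theorem determinedBy_superset (B : Set V) : DeterminedBy B {ω : Set V | B ⊆ ω} :=
  fun _ _ h => forall₂_congr fun v hv => h v hv

variable [Fintype V]

open Classical in
/-- The probability of a single configuration. -/
noncomputable def configWeight (p : I) (s : Set V) : ℝ := ∏ v : V, if v ∈ s then (p : ℝ) else 1 - p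

theorem configWeight_nonneg (s : Set V) : 0 ≤ configWeight p s :=
  Finset.prod_nonneg fun v _ => by
    split_ifs
    · exact p.2.1
    · linarith [p.2.2]

theorem setBernoulli_real_singleton_eq_configWeight (s : Set V) :
    (setBernoulli Set.univ p).real {s} = configWeight p s := by
  classical
  rw [setBernoulli_real_singleton p (Set.subset_univ s) Set.finite_univ, configWeight,
    Finset.prod_ite]
  simp only [Finset.prod_const]
  congr 2
  · rw [Set.ncard_eq_toFinset_card']; congr 1; ext; simp
  · rw [Set.ncard_eq_toFinset_card']; congr 1; ext; simp

open Classical in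
theorem setBernoulli_real_eq_sum (E : Set (Set V)) :
    (setBernoulli Set.univ p).real E = ∑ s : Set V, configWeight p s * if s ∈ E then 1 else 0 := by
  have h : E = ⋃ s ∈ (Finset.univ.filter (· ∈ E) : Finset (Set V)), {s} := by ext; simp
  conv_lhs => rw [h]
  rw [measureReal_biUnion_finset (fun a _ b _ hab => by simpa using hab) (by simp)]
  simp_rw [setBernoulli_real_singleton_eq_configWeight]
  simp [Finset.sum_filter]

open Classical in
theorem sum_configWeight : ∑ s : Set V, configWeight p s = 1 := by
  have := setBernoulli_real_eq_sum (p := p) (Set.univ : Set (Set V))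
  simpa using this.symm

/-- **Harris' inequality** for increasing events. -/
theorem setBernoulli_harris_upper {E F : Set (Set V)} (hE : IsUpperSet E) (hF : IsUpperSet F) :
    (setBernoulli Set.univ p).real E * (setBernoulli Set.univ p).real F ≤
      (setBernoulli Set.univ p).real (E ∩ F) := by
  classical
  have hmono : ∀ {G : Set (Set V)}, IsUpperSet G →
      Monotone (fun s : Set V => if s ∈ G then (1 : ℝ) else 0) := by
    intro G hG s t hst
    dsimp only
    split_ifs with h1 h2
    · rfl
    · exact absurd (hG hst h1) h2
    · norm_num
    · rfl
  -- A product weight satisfies the FKG lattice condition with equality.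
  have key := fkg (α := Set V) (μ := configWeight p)
    (f := fun s => if s ∈ E then (1 : ℝ) else 0) (g := fun s => if s ∈ F then (1 : ℝ) else 0)
    (fun s => configWeight_nonneg s)
    (fun s => by dsimp only [Pi.zero_apply]; split_ifs <;> norm_num)
    (fun s => by dsimp only [Pi.zero_apply]; split_ifs <;> norm_num)
    (hmono hE) (hmono hF) (fun s t => by
      rw [configWeight, configWeight, configWeight, configWeight, ← Finset.prod_mul_distrib,
        ← Finset.prod_mul_distrib]
      refine le_of_eq (Finset.prod_congr rfl fun v _ => ?_)
      by_cases h1 : v ∈ s <;> by_cases h2 : v ∈ t <;> simp [h1, h2, mul_comm])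
  rw [sum_configWeight, one_mul] at key
  rw [setBernoulli_real_eq_sum, setBernoulli_real_eq_sum, setBernoulli_real_eq_sum]
  refine key.trans (le_of_eq (Finset.sum_congr rfl fun s _ => ?_))
  by_cases h1 : s ∈ E <;> by_cases h2 : s ∈ F <;> simp [h1, h2]

/-- **Harris' inequality** for decreasing events. -/
theorem setBernoulli_harris_lower {E F : Set (Set V)} (hE : IsLowerSet E) (hF : IsLowerSet F) :
    (setBernoulli Set.univ p).real E * (setBernoulli Set.univ p).real F ≤
      (setBernoulli Set.univ p).real (E ∩ F) := by
  have key := setBernoulli_harris_upper (p := p) hE.compl hF.compl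
  have h1 := measureReal_union_add_inter (μ := setBernoulli Set.univ p) (s := E)
    (MeasurableSet.of_discrete (s := F))
  rw [← Set.compl_union, probReal_compl_eq_one_sub MeasurableSet.of_discrete,
    probReal_compl_eq_one_sub MeasurableSet.of_discrete,
    probReal_compl_eq_one_sub MeasurableSet.of_discrete] at key
  nlinarith

/-- Events that depend on disjoint sets of vertices are independent. -/
theorem setBernoulli_real_inter {A B : Set V} {E F : Set (Set V)} (hE : DeterminedBy A E)
    (hF : DeterminedBy B F) (hAB : Disjoint A B) :
    (setBernoulli Set.univ p).real (E ∩ F) =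
      (setBernoulli Set.univ p).real E * (setBernoulli Set.univ p).real F := by
  classical
  -- Two independent copies exchange their parts outside `A`, which preserves the product weight.
  -- The new first copy satisfies `E` exactly if the old first one does, and `F` exactly if the old
  -- second one does.
  let swap : Set V × Set V → Set V × Set V := fun x =>
    ({v | if v ∈ A then v ∈ x.1 else v ∈ x.2}, {v | if v ∈ A then v ∈ x.2 else v ∈ x.1})
  have hswap : Function.Involutive swap := by
    rintro ⟨s, t⟩
    ext v <;> by_cases hv : v ∈ A <;> simp [swap, hv]
  have key : ∑ x : Set V × Set V, (configWeight p x.1 * if x.1 ∈ E then 1 else 0) *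
      (configWeight p x.2 * if x.2 ∈ F then 1 else 0) =
      ∑ x : Set V × Set V, (configWeight p x.1 * if x.1 ∈ E ∩ F then 1 else 0) *
        configWeight p x.2 := by
    refine Fintype.sum_equiv hswap.toPerm _ _ ?_
    rintro ⟨s, t⟩
    have h1 : (swap (s, t)).1 ∈ E ↔ s ∈ E := hE _ _ fun v hv => by simp [swap, hv]
    have h2 : (swap (s, t)).1 ∈ F ↔ t ∈ F := hF _ _ fun v hv => by
      simp [swap, Set.disjoint_right.1 hAB hv]
    have h3 : configWeight p s * configWeight p t =
        configWeight p (swap (s, t)).1 * configWeight p (swap (s, t)).2 := by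
      rw [configWeight, configWeight, configWeight, configWeight, ← Finset.prod_mul_distrib,
        ← Finset.prod_mul_distrib]
      refine Finset.prod_congr rfl fun v _ => ?_
      by_cases hv : v ∈ A <;> simp [swap, hv, mul_comm]
    simp only [Function.Involutive.coe_toPerm, Set.mem_inter_iff, h1, h2]
    rw [mul_mul_mul_comm, h3]
    by_cases hs : s ∈ E <;> by_cases ht : t ∈ F <;> simp [hs, ht]
  rw [Fintype.sum_prod_type, Fintype.sum_prod_type] at key
  rw [setBernoulli_real_eq_sum E, setBernoulli_real_eq_sum F, Finset.sum_mul_sum]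
  refine Eq.trans ?_ key.symm
  rw [setBernoulli_real_eq_sum, ← mul_one (∑ s, _)]
  conv_lhs => arg 2; rw [← sum_configWeight (V := V) (p := p)]
  rw [Finset.sum_mul_sum]
  refine Finset.sum_congr rfl fun x _ => Finset.sum_congr rfl fun y _ => ?_
  congr

theorem setBernoulli_real_iInter_compl_le {ι : Type*} (s : Finset ι) {A : ι → Set V}
    {E : ι → Set (Set V)} (hE : ∀ i ∈ s, DeterminedBy (A i) (E i))
    (hA : ∀ i ∈ s, ∀ j ∈ s, i ≠ j → Disjoint (A i) (A j)) :
    (setBernoulli Set.univ p).real (⋂ i ∈ s, (E i)ᶜ) ≤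
      Real.exp (-∑ i ∈ s, (setBernoulli Set.univ p).real (E i)) := by
  classical
  induction s using Finset.induction_on with
  | empty => simp
  | insert i s hi ih =>
    rw [Finset.set_biInter_insert, Finset.sum_insert hi, neg_add, Real.exp_add]
    have hdet : DeterminedBy (⋃ j ∈ s, A j) (⋂ j ∈ s, (E j)ᶜ) :=
      DeterminedBy.iInter (s := (s : Set ι)) fun j hj =>
        (hE j (Finset.mem_insert_of_mem hj)).compl
    rw [setBernoulli_real_inter (hE i (Finset.mem_insert_self i s)).compl hdet (by
      simp only [Set.disjoint_iUnion_right]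
      intro j hj
      exact hA i (Finset.mem_insert_self i s) j (Finset.mem_insert_of_mem hj)
        fun h => hi (h ▸ hj))]
    refine mul_le_mul ?_ (ih (fun j hj => hE j (Finset.mem_insert_of_mem hj)) fun j hj k hk =>
      hA j (Finset.mem_insert_of_mem hj) k (Finset.mem_insert_of_mem hk)) measureReal_nonneg
      (Real.exp_pos _).le
    rw [probReal_compl_eq_one_sub MeasurableSet.of_discrete]
    linarith [Real.add_one_le_exp (-(setBernoulli Set.univ p).real (E i))]

/-- The probability that none of the sets of a finite family is fully open is bounded below in
terms of the expected number of fully open sets. -/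
theorem exp_le_setBernoulli_real_forall_not_superset (F : Finset (Finset V))
    (hF : ∀ B ∈ F, B.Nonempty) (hp : (p : ℝ) ≤ 1 / 2) :
    Real.exp (-(2 * ∑ B ∈ F, (p : ℝ) ^ B.card)) ≤
      (setBernoulli Set.univ p).real {ω | ∀ B ∈ F, ¬ (B : Set V) ⊆ ω} := by
  classical
  induction F using Finset.induction_on with
  | empty => simp
  | insert B F hB ih =>
    have h1 : {ω : Set V | ∀ C ∈ insert B F, ¬ (C : Set V) ⊆ ω} =
        {ω | ¬ (B : Set V) ⊆ ω} ∩ {ω | ∀ C ∈ F, ¬ (C : Set V) ⊆ ω} := by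
      ext ω; simp
    rw [h1, Finset.sum_insert hB, mul_add, neg_add, Real.exp_add]
    refine le_trans (mul_le_mul ?_ (ih fun C hC => hF C (Finset.mem_insert_of_mem hC))
      (Real.exp_pos _).le measureReal_nonneg) (setBernoulli_harris_lower
        (isLowerSet_not_superset _) (fun s t hst hs C hC => isLowerSet_not_superset _ hst (hs C hC)))
    have h2 : {ω : Set V | ¬ (B : Set V) ⊆ ω} = {ω | (B : Set V) ⊆ ω}ᶜ := rfl
    rw [h2, probReal_compl_eq_one_sub MeasurableSet.of_discrete, setBernoulli_real_superset]
    -- What remains is `exp (-2x) ≤ 1 - x`, valid for `0 ≤ x ≤ 1/2`; nonemptiness of `B` is needed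
    -- for `x ≤ p`.
    have hx0 : 0 ≤ (p : ℝ) ^ B.card := pow_nonneg p.2.1 _
    have hx1 : (p : ℝ) ^ B.card ≤ 1 / 2 :=
      (pow_le_of_le_one p.2.1 p.2.2
        (Finset.card_pos.2 (hF B (Finset.mem_insert_self B F))).ne').trans hp
    set x := (p : ℝ) ^ B.card
    have h3 : Real.exp (-(2 * x)) * Real.exp (2 * x) = 1 := by rw [← Real.exp_add]; simp
    have h4 := Real.add_one_le_exp (2 * x)
    have h5 := Real.exp_pos (-(2 * x))
    have h6 : Real.exp (-(2 * x)) * (1 + 2 * x) ≤ 1 := by nlinarith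
    nlinarith
end SetBernoulli

/-! ### Bootstrap percolation and stable sets -/

section Bootstrap
variable {d n : ℕ}

/-- `K` is stable under bootstrap percolation with threshold `2` on the Hamming torus. -/
def IsStable (K : Set (Fin d → Fin n)) : Prop :=
  ∀ (x : Fin d → Fin n) (l m : Fin d) (b c : Fin n), b ≠ x l → c ≠ x m →
    Function.update x l b ≠ Function.update x m c →
    Function.update x l b ∈ K → Function.update x m c ∈ K → x ∈ K

theorem hammingDist_eq_one_iff {x y : Fin d → Fin n} :
    hammingDist x y = 1 ↔ ∃ l b, b ≠ x l ∧ y = Function.update x l b := by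
  constructor
  · intro h
    obtain ⟨l, hl⟩ := Finset.card_eq_one.1 h
    have hmem : ∀ m, x m ≠ y m ↔ m = l := fun m => by
      simpa using Finset.ext_iff.1 hl m
    refine ⟨l, y l, fun h => (hmem l).2 rfl h.symm, ?_⟩
    ext m
    by_cases hm : m = l
    · subst hm; simp
    · rw [Function.update_of_ne hm]
      exact congrArg _ (not_not.1 fun h => hm ((hmem m).1 fun h' => h h'.symm))
  · rintro ⟨l, b, hb, rfl⟩
    refine Finset.card_eq_one.2 ⟨l, ?_⟩
    ext m
    by_cases hm : m = l
    · subst hm; simpa using hb.symm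
    · simp [hm]

theorem mem_bootstrapStep_iff {S : Set (Fin d → Fin n)} {x : Fin d → Fin n} :
    x ∈ bootstrapStep (hammingTorus d n) 2 S ↔ x ∈ S ∨
      ∃ l m b c, b ≠ x l ∧ c ≠ x m ∧ Function.update x l b ≠ Function.update x m c ∧
        Function.update x l b ∈ S ∧ Function.update x m c ∈ S := by
  refine or_congr Iff.rfl ?_
  have h2 : ((2 : ℕ) : ℕ∞) = 1 + 1 := rfl
  rw [h2, ENat.add_one_le_iff (by simp), Set.one_lt_encard_iff]
  constructor
  · rintro ⟨y, z, ⟨hy, hyS⟩, ⟨hz, hzS⟩, hyz⟩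
    obtain ⟨l, b, hb, rfl⟩ := hammingDist_eq_one_iff.1 hy
    obtain ⟨m, c, hc, rfl⟩ := hammingDist_eq_one_iff.1 hz
    exact ⟨l, m, b, c, hb, hc, hyz, hyS, hzS⟩
  · rintro ⟨l, m, b, c, hb, hc, hbc, h1, h2⟩
    exact ⟨_, _, ⟨hammingDist_eq_one_iff.2 ⟨l, b, hb, rfl⟩, h1⟩,
      ⟨hammingDist_eq_one_iff.2 ⟨m, c, hc, rfl⟩, h2⟩, hbc⟩

theorem subset_bootstrapSpan (S : Set (Fin d → Fin n)) :
    S ⊆ bootstrapSpan (hammingTorus d n) 2 S :=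
  fun _ hx => Set.mem_iUnion.2 ⟨0, hx⟩

theorem bootstrapSpan_subset {S K : Set (Fin d → Fin n)} (hK : IsStable K) (hS : S ⊆ K) :
    bootstrapSpan (hammingTorus d n) 2 S ⊆ K := by
  refine Set.iUnion_subset fun t => ?_
  induction t with
  | zero => exact hS
  | succ t ih =>
    rw [Function.iterate_succ_apply']
    intro x hx
    rcases mem_bootstrapStep_iff.1 hx with hx | ⟨l, m, b, c, hb, hc, hbc, h1, h2⟩
    · exact ih hx
    · exact hK x l m b c hb hc hbc (ih h1) (ih h2)

theorem isStable_bootstrapSpan (S : Set (Fin d → Fin n)) :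
    IsStable (bootstrapSpan (hammingTorus d n) 2 S) := by
  have hmono : Monotone fun t => (bootstrapStep (hammingTorus d n) 2)^[t] S := by
    refine monotone_nat_of_le_succ fun t => ?_
    rw [Function.iterate_succ_apply']
    exact fun x hx => Or.inl hx
  intro x l m b c hb hc hbc h1 h2
  obtain ⟨s, hs⟩ := Set.mem_iUnion.1 h1
  obtain ⟨t, ht⟩ := Set.mem_iUnion.1 h2
  refine Set.mem_iUnion.2 ⟨max s t + 1, ?_⟩
  rw [Function.iterate_succ_apply']
  exact mem_bootstrapStep_iff.2 (Or.inr ⟨l, m, b, c, hb, hc, hbc,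
    hmono (le_max_left s t) hs, hmono (le_max_right s t) ht⟩)

theorem bootstrapSpan_mono {S T : Set (Fin d → Fin n)} (h : S ⊆ T) :
    bootstrapSpan (hammingTorus d n) 2 S ⊆ bootstrapSpan (hammingTorus d n) 2 T :=
  bootstrapSpan_subset (isStable_bootstrapSpan T) (h.trans (subset_bootstrapSpan T))

/-! ### Subtori: distance, joins and growth -/

/-- A subtorus of `[n]^d`: the coordinate `l` is fixed to `x` if `W l = some x`, and is free if
`W l = none`. -/
abbrev Cube (d n : ℕ) : Type := Fin d → Option (Fin n)

namespace Cube

/-- The free coordinates. -/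
def free (W : Cube d n) : Finset (Fin d) := Finset.univ.filter fun l => W l = none

/-- The dimension. -/
def dim (W : Cube d n) : ℕ := W.free.card

/-- The set of vertices. -/
def toSet (W : Cube d n) : Set (Fin d → Fin n) := {v | ∀ l x, W l = some x → v l = x}

/-- A vertex as a subtorus of dimension `0`. -/
def ofVertex (v : Fin d → Fin n) : Cube d n := fun l => some (v l)

/-- The smallest subtorus that contains two given ones. -/
def join (W₁ W₂ : Cube d n) : Cube d n := fun l => if W₁ l = W₂ l then W₁ l else none

/-- The coordinates that two subtori fix to different values. -/
def conflict (W₁ W₂ : Cube d n) : Finset (Fin d) :=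
  Finset.univ.filter fun l => W₁ l ≠ none ∧ W₂ l ≠ none ∧ W₁ l ≠ W₂ l

/-- Two subtori are at Hamming distance at most `2`. -/
def Near (W₁ W₂ : Cube d n) : Prop := (conflict W₁ W₂).card ≤ 2

/-- `W₁` is a subtorus of `W₂`. -/
def Sub (W₁ W₂ : Cube d n) : Prop := ∀ l x, W₂ l = some x → W₁ l = some x

theorem Sub.toSet_subset {W₁ W₂ : Cube d n} (h : W₁.Sub W₂) : W₁.toSet ⊆ W₂.toSet :=
  fun _ hv l x hx => hv l x (h l x hx)

theorem Sub.free_subset {W₁ W₂ : Cube d n} (h : W₁.Sub W₂) : W₁.free ⊆ W₂.free := by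
  intro l hl
  simp only [free, Finset.mem_filter, Finset.mem_univ, true_and] at hl ⊢
  by_contra h2
  obtain ⟨x, hx⟩ := Option.ne_none_iff_exists'.1 h2
  simp [h l x hx] at hl

theorem Sub.antisymm {W₁ W₂ : Cube d n} (h : W₁.Sub W₂) (h' : W₂.Sub W₁) : W₁ = W₂ := by
  funext l
  exact Option.ext fun x => ⟨fun hx => h' l x hx, fun hx => h l x hx⟩

theorem Sub.eq_of_dim_le {W₁ W₂ : Cube d n} (h : W₁.Sub W₂) (hd : W₂.dim ≤ W₁.dim) :
    W₁ = W₂ := by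
  have hfree := Finset.eq_of_subset_of_card_le h.free_subset hd
  refine h.antisymm fun l x hx => ?_
  have hl : l ∉ W₂.free := by rw [← hfree]; simp [free, hx]
  simp only [free, Finset.mem_filter, Finset.mem_univ, true_and] at hl
  obtain ⟨y, hy⟩ := Option.ne_none_iff_exists'.1 hl
  have := h l y hy
  rw [hx] at this
  rw [hy, this]

theorem Sub.dim_lt {W₁ W₂ : Cube d n} (h : W₁.Sub W₂) (hne : W₁ ≠ W₂) : W₁.dim < W₂.dim :=
  not_le.1 fun hd => hne (h.eq_of_dim_le hd)

theorem sub_join_left (W₁ W₂ : Cube d n) : W₁.Sub (join W₁ W₂) := by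
  intro l x hx
  simp only [join] at hx
  split_ifs at hx
  exact hx

theorem sub_join_right (W₁ W₂ : Cube d n) : W₂.Sub (join W₁ W₂) := by
  intro l x hx
  simp only [join] at hx
  split_ifs at hx with h
  rw [← h]; exact hx

theorem join_sub {W₁ W₂ T : Cube d n} (h₁ : W₁.Sub T) (h₂ : W₂.Sub T) : (join W₁ W₂).Sub T := by
  intro l x hx
  simp [join, h₁ l x hx, h₂ l x hx]

theorem dim_join_le (W₁ W₂ : Cube d n) :
    (join W₁ W₂).dim ≤ W₁.dim + W₂.dim + (conflict W₁ W₂).card := by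
  refine le_trans (Finset.card_le_card (t := W₁.free ∪ W₂.free ∪ conflict W₁ W₂) fun l hl => ?_)
    ((Finset.card_union_le _ _).trans (Nat.add_le_add_right (Finset.card_union_le _ _) _))
  simp only [free, join, conflict, Finset.mem_filter, Finset.mem_univ, true_and,
    Finset.mem_union] at hl ⊢
  by_cases h : W₁ l = W₂ l <;> simp_all
  tauto

theorem conflict_comm (W₁ W₂ : Cube d n) : conflict W₁ W₂ = conflict W₂ W₁ := by
  ext l
  simp only [conflict, Finset.mem_filter, Finset.mem_univ, true_and]
  tauto

theorem Near.symm {W₁ W₂ : Cube d n} (h : W₁.Near W₂) : W₂.Near W₁ := by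
  rwa [Near, conflict_comm]

/-- Away from `l` and `m` both points agree with `x`, so only these two coordinates can be in
conflict. Hence two subtori can jointly open a vertex only at distance at most two. -/
theorem near_of_update {W₁ W₂ : Cube d n} {x : Fin d → Fin n} {l m : Fin d} {b c : Fin n}
    (h₁ : Function.update x l b ∈ W₁.toSet) (h₂ : Function.update x m c ∈ W₂.toSet) :
    W₁.Near W₂ := by
  refine le_trans (Finset.card_le_card (t := {l, m}) fun k hk => ?_) Finset.card_le_two
  simp only [conflict, Finset.mem_filter, Finset.mem_univ, true_and] at hk
  obtain ⟨y, hy⟩ := Option.ne_none_iff_exists'.1 hk.1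
  obtain ⟨z, hz⟩ := Option.ne_none_iff_exists'.1 hk.2.1
  by_contra hlm
  simp only [Finset.mem_insert, Finset.mem_singleton, not_or] at hlm
  have e1 := h₁ k y hy
  have e2 := h₂ k z hz
  rw [Function.update_of_ne hlm.1] at e1
  rw [Function.update_of_ne hlm.2] at e2
  exact hk.2.2 (by rw [hy, hz, ← e1, ← e2])

theorem isStable_toSet (W : Cube d n) : IsStable W.toSet := by
  intro x l m b c hb hc hne h₁ h₂ k y hk
  have e1 := h₁ k y hk
  have e2 := h₂ k y hk
  by_cases hkl : k = l
  · by_cases hkm : k = m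
    · subst hkl hkm
      simp only [Function.update_self] at e1 e2
      exact absurd (by rw [e1, e2]) hne
    · rwa [Function.update_of_ne hkm] at e2
  · rwa [Function.update_of_ne hkl] at e1

/-- Two open neighbours of a vertex lie either in one member, which is itself stable, or in two
members, which would then be near. Such unions serve as outer bounds for spans. -/
theorem isStable_biUnion {C : Set (Cube d n)}
    (hC : ∀ W ∈ C, ∀ W' ∈ C, W ≠ W' → ¬ W.Near W') : IsStable (⋃ W ∈ C, W.toSet) := by
  intro x l m b c hb hc hne h₁ h₂
  simp only [Set.mem_iUnion, exists_prop] at h₁ h₂ ⊢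
  obtain ⟨W, hW, h₁⟩ := h₁
  obtain ⟨W', hW', h₂⟩ := h₂
  by_cases h : W = W'
  · subst h
    exact ⟨W, hW, isStable_toSet W x l m b c hb hc hne h₁ h₂⟩
  · exact absurd (near_of_update h₁ h₂) (hC W hW W' hW' h)

theorem toSet_nonempty (hn : 0 < n) (W : Cube d n) : W.toSet.Nonempty :=
  ⟨fun l => (W l).getD ⟨0, hn⟩, fun l x hx => by simp [hx]⟩

/-- A subtorus that is covered by subtori which are pairwise far apart lies in one of them. -/
theorem exists_sub_of_toSet_subset_biUnion {C : Set (Cube d n)}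
    (hC : ∀ W ∈ C, ∀ W' ∈ C, W ≠ W' → ¬ W.Near W') (hn : 2 ≤ n) {T : Cube d n}
    (hT : T.toSet ⊆ ⋃ W ∈ C, W.toSet) : ∃ W ∈ C, T.Sub W := by
  obtain ⟨v, hv⟩ := T.toSet_nonempty (by omega)
  have hvC := hT hv
  simp only [Set.mem_iUnion, exists_prop] at hvC
  obtain ⟨W, hW, hvW⟩ := hvC
  refine ⟨W, hW, fun l x hx => ?_⟩
  have hvl := hvW l x hx
  rcases hTl : T l with _ | y
  -- If `T` is free where `W` is fixed, moving `v` in direction `l` leaves `W` but stays covered, so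
  -- another member is at distance at most one from `W`.
  · obtain ⟨y, hy⟩ : ∃ y : Fin n, y ≠ x := by
      have : Nontrivial (Fin n) := Fin.nontrivial_iff_two_le.2 hn
      exact exists_ne x
    have hv' : Function.update v l y ∈ T.toSet := fun k z hz => by
      by_cases hk : k = l
      · subst hk; simp [hTl] at hz
      · rw [Function.update_of_ne hk]; exact hv k z hz
    have hvC' := hT hv'
    simp only [Set.mem_iUnion, exists_prop] at hvC'
    obtain ⟨W', hW', hvW'⟩ := hvC'
    by_cases h : W = W'
    · subst h
      exact absurd (by simpa using hvW' l x hx) hy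
    · refine absurd (near_of_update (x := v) (l := l) (b := v l) ?_ hvW') (hC W hW W' hW' h)
      rwa [Function.update_eq_self]
  · rw [← hvl, hv l y hTl]

theorem isSubtorus_toSet (hn : 0 < n) (W : Cube d n) : IsSubtorus d n W.dim W.toSet := by
  refine ⟨W.freeᶜ, fun l => (W l).getD ⟨0, hn⟩, ?_, fun v => ?_⟩
  · rw [Finset.card_compl, dim, Fintype.card_fin]
    exact Nat.sub_add_cancel (by simpa using Finset.card_le_univ W.free)
  · refine forall_congr' fun l => ?_
    rcases h : W l with _ | x <;> simp [free, h]

theorem exists_of_isSubtorus {i : ℕ} {V : Set (Fin d → Fin n)} (h : IsSubtorus d n i V) :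
    ∃ W : Cube d n, W.dim = i ∧ W.toSet = V := by
  obtain ⟨I, α, hI, hV⟩ := h
  refine ⟨fun l => if l ∈ I then some (α l) else none, ?_, ?_⟩
  · have : free (fun l => if l ∈ I then some (α l) else none) = Iᶜ := by
      ext l; simp [free]
    rw [dim, this, Finset.card_compl, Fintype.card_fin]
    omega
  · ext v
    rw [hV, toSet, Set.mem_ofPred_eq]
    refine forall_congr' fun l => ?_
    by_cases hl : l ∈ I <;> simp [hl, eq_comm]

/-- A stable set that contains a subtorus and a vertex at distance `1` from it contains the
subtorus that they generate. -/
theorem update_none_subset {K : Set (Fin d → Fin n)} (hK : IsStable K) {W : Cube d n}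
    (hW : W.toSet ⊆ K) {v : Fin d → Fin n} (hv : v ∈ K) {l : Fin d} {x₀ : Fin n}
    (hl : W l = some x₀) (hvl : v l ≠ x₀)
    (hvW : v ∈ toSet (Function.update W l none : Cube d n)) :
    toSet (Function.update W l none : Cube d n) ⊆ K := by
  have hmem : ∀ u ∈ toSet (Function.update W l none : Cube d n),
      Function.update u l x₀ ∈ W.toSet := by
    intro u hu k z hz
    by_cases hk : k = l
    · subst hk
      rw [hl] at hz
      simpa using hz
    · rw [Function.update_of_ne hk]
      exact hu k z (by rwa [Function.update_of_ne hk])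
  -- The slice through `v` parallel to `W` opens outwards from `v`: each of its vertices has a
  -- neighbour in `W` and one closer to `v` in the slice.
  have hslice : ∀ s : Finset (Fin d), ∀ u ∈ toSet (Function.update W l none : Cube d n),
      u l = v l → (∀ m ∉ s, u m = v m) → u ∈ K := by
    intro s
    induction s using Finset.induction_on with
    | empty =>
      intro u _ _ h
      rwa [show u = v from funext fun m => h m (by simp)]
    | insert m s hm ih =>
      intro u hu hul h
      by_cases hum : u m = v m
      · refine ih u hu hul fun k hk => ?_
        by_cases hkm : k = m
        · rw [hkm, hum]
        · exact h k (by simp [hk, hkm])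
      · have hml : m ≠ l := fun e => hum (e ▸ hul)
        refine hK u m l (v m) x₀ (Ne.symm hum) (by rw [hul]; exact hvl.symm) ?_
          (ih _ ?_ ?_ ?_) (hW (hmem u hu))
        · intro e
          have := congrFun e l
          rw [Function.update_of_ne hml.symm, Function.update_self, hul] at this
          exact hvl this
        · intro k z hz
          by_cases hk : k = m
          · subst hk
            rw [Function.update_self]; exact hvW k z hz
          · rw [Function.update_of_ne hk]; exact hu k z hz
        · rw [Function.update_of_ne hml.symm, hul]
        · intro k hk
          by_cases hkm : k = m
          · subst hkm; simp
          · rw [Function.update_of_ne hkm]; exact h k (by simp [hk, hkm])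
  intro u hu
  by_cases h0 : u l = x₀
  · have := hmem u hu
    rw [← h0, Function.update_eq_self] at this
    exact hW this
  by_cases h1 : u l = v l
  · exact hslice Finset.univ u hu h1 (by simp)
  -- On the line through `u` in direction `l`, the points in `W` and in the slice of `v` are both
  -- open.
  · refine hK u l l x₀ (v l) (Ne.symm h0) (Ne.symm h1) ?_ (hW (hmem u hu)) ?_
    · intro e
      have := congrFun e l
      simp only [Function.update_self] at this
      exact hvl this.symm
    · refine hslice Finset.univ _ ?_ (by simp) (by simp)
      intro k z hz
      by_cases hk : k = l
      · subst hk; simp at hz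
      · rw [Function.update_of_ne hk]; exact hu k z hz

/-- A stable set that contains a subtorus and a vertex at distance `2` from it contains the
subtorus that they generate. -/
theorem update_none_update_none_subset {K : Set (Fin d → Fin n)} (hK : IsStable K) {W : Cube d n}
    (hW : W.toSet ⊆ K) {v : Fin d → Fin n} (hv : v ∈ K) {l m : Fin d} (hlm : l ≠ m)
    {x₀ y₀ : Fin n} (hl : W l = some x₀) (hm : W m = some y₀) (hvl : v l ≠ x₀) (hvm : v m ≠ y₀)
    (hvW : v ∈ toSet (Function.update (Function.update W l none) m none : Cube d n)) :
    toSet (Function.update (Function.update W l none) m none : Cube d n) ⊆ K := by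
  have hu1 : Function.update v m y₀ ∈ toSet (Function.update W l none : Cube d n) := by
    intro k z hz
    by_cases hk : k = m
    · subst hk
      rw [Function.update_of_ne hlm.symm, hm] at hz
      simpa using hz
    · rw [Function.update_of_ne hk]
      exact hvW k z (by rwa [Function.update_of_ne hk])
  have hu2 : Function.update (Function.update v m y₀) l x₀ ∈ W.toSet := by
    intro k z hz
    by_cases hk : k = l
    · subst hk
      rw [hl] at hz
      simpa using hz
    · rw [Function.update_of_ne hk]
      exact hu1 k z (by rwa [Function.update_of_ne hk])
  -- This vertex is adjacent to `v` and to a vertex of `W`, so it opens. Being at distance one from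
  -- `W`, it reduces the claim to two extensions by distance one.
  have hu : Function.update v m y₀ ∈ K := by
    refine hK _ m l (v m) x₀ (by simpa using hvm)
      (by rw [Function.update_of_ne hlm]; exact hvl.symm) ?_ (by simpa using hv) (hW hu2)
    intro e
    have := congrFun e l
    simp only [Function.update_idem, Function.update_eq_self, Function.update_self] at this
    exact hvl this
  refine update_none_subset hK (update_none_subset hK hW hu hl ?_ hu1) hv (x₀ := y₀) ?_ hvm hvW
  · rwa [Function.update_of_ne hlm]
  · rwa [Function.update_of_ne hlm.symm]

end Cube

/-- Directions can be freed one at a time: after other directions are freed, the witness for `l` is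
still at distance one, differing only in coordinate `l`. -/
theorem IsStable.univ_subset_of_forall_exists {K : Set (Fin d → Fin n)} (hK : IsStable K)
    {W : Cube d n} (hW : W.toSet ⊆ K)
    (h : ∀ l x₀, W l = some x₀ → ∃ v ∈ K, v l ≠ x₀ ∧
      v ∈ Cube.toSet (Function.update W l none : Cube d n)) : K = Set.univ := by
  have key : ∀ s : Finset (Fin d),
      Cube.toSet (fun l => if l ∈ s then none else W l : Cube d n) ⊆ K := by
    intro s
    induction s using Finset.induction_on with
    | empty => simpa using hW
    | insert l s hls ih =>
      have hupd : (fun k => if k ∈ insert l s then none else W k : Cube d n) =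
          Function.update (fun k => if k ∈ s then none else W k : Cube d n) l none := by
        funext k
        by_cases hk : k = l
        · subst hk; simp
        · simp [hk]
      rw [hupd]
      rcases hl : W l with _ | x₀
      · rw [show Function.update (fun k => if k ∈ s then none else W k : Cube d n) l none =
          (fun k => if k ∈ s then none else W k : Cube d n) from
          Function.update_eq_self_iff.2 (by simp [hl])]
        exact ih
      · obtain ⟨v, hvK, hvl, hvW⟩ := h l x₀ hl
        refine Cube.update_none_subset hK ih hvK (by simp [hls, hl]) hvl fun k z hz => ?_
        by_cases hk : k = l
        · subst hk; simp at hz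
        · rw [Function.update_of_ne hk] at hz
          refine hvW k z ?_
          rw [Function.update_of_ne hk]
          split_ifs at hz
          exact hz
  exact Set.eq_univ_of_univ_subset fun v _ => key Finset.univ (by intro l x hx; simp at hx)

/-! ### Assembling subtori by successive mergers -/

/-- The open set `B` is assembled into the subtorus `W` by successive mergers of subtori at distance
at most `2`, starting from single vertices. -/
inductive Assembles : Finset (Fin d → Fin n) → Cube d n → Prop
  | single (v : Fin d → Fin n) : Assembles {v} (Cube.ofVertex v)
  | merge {B₁ B₂ : Finset (Fin d → Fin n)} {W₁ W₂ : Cube d n} (h₁ : Assembles B₁ W₁)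
      (h₂ : Assembles B₂ W₂) (hB : Disjoint B₁ B₂) (hW : W₁.Near W₂)
      (hne₁ : W₁ ≠ Cube.join W₁ W₂) (hne₂ : W₂ ≠ Cube.join W₁ W₂) :
      Assembles (B₁ ∪ B₂) (Cube.join W₁ W₂)

namespace Assembles

theorem nonempty {B : Finset (Fin d → Fin n)} {W : Cube d n} (h : Assembles B W) :
    B.Nonempty := by
  induction h with
  | single v => exact Finset.singleton_nonempty v
  | merge _ _ _ _ _ _ ih _ => exact ih.mono Finset.subset_union_left

theorem subset {B : Finset (Fin d → Fin n)} {W : Cube d n} (h : Assembles B W) :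
    (B : Set (Fin d → Fin n)) ⊆ W.toSet := by
  induction h with
  | single v => simp [Cube.toSet, Cube.ofVertex]
  | merge _ _ _ _ _ _ ih₁ ih₂ =>
    rw [Finset.coe_union]
    exact Set.union_subset (ih₁.trans (Cube.sub_join_left _ _).toSet_subset)
      (ih₂.trans (Cube.sub_join_right _ _).toSet_subset)

theorem sub {B : Finset (Fin d → Fin n)} {W T : Cube d n} (h : Assembles B W)
    (hB : (B : Set (Fin d → Fin n)) ⊆ T.toSet) : W.Sub T := by
  induction h with
  | single v =>
    have hv : v ∈ T.toSet := hB (by simp)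
    exact fun l x hx => by rw [Cube.ofVertex, hv l x hx]
  | merge _ _ _ _ _ _ ih₁ ih₂ =>
    rw [Finset.coe_union, Set.union_subset_iff] at hB
    exact Cube.join_sub (ih₁ hB.1) (ih₂ hB.2)

theorem dim_ofVertex (v : Fin d → Fin n) : (Cube.ofVertex v).dim = 0 := by
  simp [Cube.dim, Cube.free, Cube.ofVertex]

/-- The first merger that reaches dimension `k`. -/
theorem exists_first_merge {k : ℕ} (hk : 0 < k) {B : Finset (Fin d → Fin n)} {W : Cube d n}
    (h : Assembles B W) (hW : k ≤ W.dim) :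
    ∃ B₁ B₂ W₁ W₂, Assembles B₁ W₁ ∧ Assembles B₂ W₂ ∧ Disjoint B₁ B₂ ∧ Cube.Near W₁ W₂ ∧
      W₁.dim < k ∧ W₂.dim < k ∧ k ≤ (Cube.join W₁ W₂).dim ∧ B₁ ∪ B₂ ⊆ B := by
  induction h with
  | single v => rw [dim_ofVertex] at hW; omega
  | @merge B₁ B₂ W₁ W₂ h₁ h₂ hB hN _ _ ih₁ ih₂ =>
    by_cases hk₁ : k ≤ W₁.dim
    · obtain ⟨C₁, C₂, U₁, U₂, a1, a2, a3, a4, a5, a6, a7, a8⟩ := ih₁ hk₁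
      exact ⟨C₁, C₂, U₁, U₂, a1, a2, a3, a4, a5, a6, a7, a8.trans Finset.subset_union_left⟩
    by_cases hk₂ : k ≤ W₂.dim
    · obtain ⟨C₁, C₂, U₁, U₂, a1, a2, a3, a4, a5, a6, a7, a8⟩ := ih₂ hk₂
      exact ⟨C₁, C₂, U₁, U₂, a1, a2, a3, a4, a5, a6, a7, a8.trans Finset.subset_union_right⟩
    exact ⟨B₁, B₂, W₁, W₂, h₁, h₂, hB, hN, not_le.1 hk₁, not_le.1 hk₂, hW, le_rfl⟩

end Assembles

/-- Every finite set of vertices is covered by subtori that are assembled from its subsets and that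
are pairwise at distance at least `3`. -/
theorem exists_assembles_cover (S : Finset (Fin d → Fin n)) :
    ∃ C : Finset (Finset (Fin d → Fin n) × Cube d n),
      (∀ c ∈ C, Assembles c.1 c.2 ∧ c.1 ⊆ S) ∧
      (∀ c ∈ C, ∀ c' ∈ C, c ≠ c' → ¬ Cube.Near c.2 c'.2) ∧ ∀ v ∈ S, ∃ c ∈ C, v ∈ Cube.toSet c.2 := by
  classical
  suffices H : ∀ k, ∀ C : Finset (Finset (Fin d → Fin n) × Cube d n), C.card = k →
      (∀ c ∈ C, Assembles c.1 c.2 ∧ c.1 ⊆ S) →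
      (∀ c ∈ C, ∀ c' ∈ C, c ≠ c' → Disjoint c.1 c'.1) → (∀ v ∈ S, ∃ c ∈ C, v ∈ Cube.toSet c.2) →
      ∃ C : Finset (Finset (Fin d → Fin n) × Cube d n),
      (∀ c ∈ C, Assembles c.1 c.2 ∧ c.1 ⊆ S) ∧
      (∀ c ∈ C, ∀ c' ∈ C, c ≠ c' → ¬ Cube.Near c.2 c'.2) ∧
        ∀ v ∈ S, ∃ c ∈ C, v ∈ Cube.toSet c.2 by
    refine H _ (S.image fun v => ({v}, Cube.ofVertex v)) rfl ?_ ?_ ?_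
    · intro c hc
      obtain ⟨v, hv, rfl⟩ := Finset.mem_image.1 hc
      exact ⟨Assembles.single v, by simpa using hv⟩
    · intro c hc c' hc' hne
      obtain ⟨v, hv, rfl⟩ := Finset.mem_image.1 hc
      obtain ⟨w, hw, rfl⟩ := Finset.mem_image.1 hc'
      rw [Finset.disjoint_singleton]
      rintro rfl
      exact hne rfl
    · intro v hv
      exact ⟨_, Finset.mem_image_of_mem _ hv, (Assembles.single v).subset (by simp)⟩
  intro k
  induction k using Nat.strong_induction_on with
  | _ k ih =>
  intro C hk h1 h2 h3
  by_cases hnear : ∀ c ∈ C, ∀ c' ∈ C, c ≠ c' → ¬ Cube.Near c.2 c'.2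
  · exact ⟨C, h1, hnear, h3⟩
  push Not at hnear
  obtain ⟨c, hc, c', hc', hne, hN⟩ := hnear
  -- `merge` demands strict growth, so if one subtorus contains the other, the larger is kept with
  -- its own seeds. In every case two members are replaced by one and the seed sets stay disjoint.
  obtain ⟨e, heA, he1, hec, hec'⟩ : ∃ e : Finset (Fin d → Fin n) × Cube d n,
      Assembles e.1 e.2 ∧ e.1 ⊆ c.1 ∪ c'.1 ∧ Cube.Sub c.2 e.2 ∧ Cube.Sub c'.2 e.2 := by
    by_cases e1 : c.2 = Cube.join c.2 c'.2
    · refine ⟨c, (h1 c hc).1, Finset.subset_union_left, fun _ _ h => h, ?_⟩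
      conv => arg 2; rw [e1]
      exact Cube.sub_join_right _ _
    by_cases e2 : c'.2 = Cube.join c.2 c'.2
    · refine ⟨c', (h1 c' hc').1, Finset.subset_union_right, ?_, fun _ _ h => h⟩
      conv => arg 2; rw [e2]
      exact Cube.sub_join_left _ _
    exact ⟨(c.1 ∪ c'.1, Cube.join c.2 c'.2),
      Assembles.merge (h1 c hc).1 (h1 c' hc').1 (h2 c hc c' hc' hne) hN e1 e2, subset_rfl,
      Cube.sub_join_left _ _, Cube.sub_join_right _ _⟩
  have hmem : ∀ {f}, f ∈ (C.erase c).erase c' ↔ f ≠ c' ∧ f ≠ c ∧ f ∈ C := by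
    intro f; simp [Finset.mem_erase]
  have hdisj : ∀ f ∈ (C.erase c).erase c', Disjoint e.1 f.1 := by
    intro f hf
    rw [hmem] at hf
    refine Finset.disjoint_of_subset_left he1 (Finset.disjoint_union_left.2
      ⟨h2 c hc f hf.2.2 (Ne.symm hf.2.1), h2 c' hc' f hf.2.2 (Ne.symm hf.1)⟩)
  refine ih (insert e ((C.erase c).erase c')).card ?_ _ rfl ?_ ?_ ?_
  · have hcard : ((C.erase c).erase c').card + 1 + 1 = C.card := by
      rw [Finset.card_erase_add_one (Finset.mem_erase.2 ⟨hne.symm, hc'⟩),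
        Finset.card_erase_add_one hc]
    have := Finset.card_insert_le e ((C.erase c).erase c')
    omega
  · intro f hf
    rcases Finset.mem_insert.1 hf with rfl | hf
    · exact ⟨heA, he1.trans (Finset.union_subset (h1 c hc).2 (h1 c' hc').2)⟩
    · exact h1 f (hmem.1 hf).2.2
  · intro f hf f' hf' hff'
    rcases Finset.mem_insert.1 hf with he | hfC <;>
      rcases Finset.mem_insert.1 hf' with he' | hfC'
    · exact absurd (he.trans he'.symm) hff'
    · exact he ▸ hdisj f' hfC'
    · exact he' ▸ (hdisj f hfC).symm
    · exact h2 f (hmem.1 hfC).2.2 f' (hmem.1 hfC').2.2 hff'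
  · intro v hv
    obtain ⟨f, hf, hvf⟩ := h3 v hv
    by_cases hfc : f = c
    · exact ⟨e, Finset.mem_insert_self _ _, hec.toSet_subset (hfc ▸ hvf)⟩
    by_cases hfc' : f = c'
    · exact ⟨e, Finset.mem_insert_self _ _, hec'.toSet_subset (hfc' ▸ hvf)⟩
    exact ⟨f, Finset.mem_insert_of_mem (hmem.2 ⟨hfc', hfc, hf⟩), hvf⟩

/-- An internally spanned subtorus is assembled from open vertices. -/
theorem exists_assembles_of_internallySpans (hn : 2 ≤ n) {S : Set (Fin d → Fin n)} {T : Cube d n}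
    (h : InternallySpans S T.toSet) :
    ∃ B : Finset (Fin d → Fin n), Assembles B T ∧ (B : Set (Fin d → Fin n)) ⊆ S ∩ T.toSet := by
  classical
  -- The union of the cover is stable, so it contains the span `T`. Then `T` lies in a single
  -- member, and that member lies in `T` because its seeds do.
  obtain ⟨C, h1, h2, h3⟩ := exists_assembles_cover (S ∩ T.toSet).toFinset
  have hfar : ∀ W ∈ Prod.snd '' (C : Set (Finset (Fin d → Fin n) × Cube d n)),
      ∀ W' ∈ Prod.snd '' (C : Set (Finset (Fin d → Fin n) × Cube d n)), W ≠ W' →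
        ¬ Cube.Near W W' := by
    rintro _ ⟨c, hc, rfl⟩ _ ⟨c', hc', rfl⟩ hne
    exact h2 c hc c' hc' fun e => hne (e ▸ rfl)
  have hcov : T.toSet ⊆ ⋃ W ∈ Prod.snd '' (C : Set (Finset (Fin d → Fin n) × Cube d n)),
      Cube.toSet W := by
    conv_lhs => rw [h]
    refine bootstrapSpan_subset (Cube.isStable_biUnion hfar) fun v hv => ?_
    obtain ⟨c, hc, hvc⟩ := h3 v (by simpa using hv)
    exact Set.mem_biUnion (Set.mem_image_of_mem _ hc) hvc
  obtain ⟨_, ⟨c, hc, rfl⟩, hTc⟩ := Cube.exists_sub_of_toSet_subset_biUnion hfar hn hcov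
  have hcS : (c.1 : Set (Fin d → Fin n)) ⊆ S ∩ T.toSet := fun v hv => by
    simpa using (h1 c hc).2 hv
  have hcT : c.2 = T := ((h1 c hc).1.sub (hcS.trans Set.inter_subset_right)).antisymm hTc
  exact ⟨c.1, hcT ▸ (h1 c hc).1, hcS⟩

end Bootstrap

/-! ### Counting subtori and weighing assembled sets -/

section Counting
variable {d n : ℕ}

theorem card_piFinset_le {α : Fin d → Type*} (g : ∀ l, Finset (α l)) (T : Finset (Fin d))
    (hT : ∀ l ∈ T, (g l).card ≤ n) (hT' : ∀ l ∉ T, (g l).card ≤ 1) :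
    (Fintype.piFinset g).card ≤ n ^ T.card := by
  rw [Fintype.card_piFinset, ← Finset.prod_mul_prod_compl T, ← mul_one (n ^ T.card),
    ← Finset.prod_const]
  refine Nat.mul_le_mul (Finset.prod_le_prod' hT) (Finset.prod_le_one' fun l hl => hT' l ?_)
  simpa using hl

namespace Cube

theorem card_image_some_le : ((Finset.univ : Finset (Fin n)).image some).card ≤ n :=
  Finset.card_image_le.trans (by simp)

open Classical in
theorem card_filter_sub_free_eq_le (W : Cube d n) (L : Finset (Fin d)) :
    (Finset.univ.filter fun W' : Cube d n => W'.Sub W ∧ W'.free = L).card ≤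
      n ^ (W.free \ L).card := by
  refine (Finset.card_le_card ?_).trans (card_piFinset_le (fun l : Fin d =>
    if l ∈ W.free \ L then Finset.univ.image some else if l ∈ L then {none} else {W l})
    (W.free \ L) (fun l hl => ?_) fun l hl => ?_)
  · intro W' hW'
    obtain ⟨hs, hL⟩ := (Finset.mem_filter.1 hW').2
    refine Fintype.mem_piFinset.2 fun l => ?_
    have h1 : l ∈ L ↔ W' l = none := by rw [← hL]; simp [free]
    have h2 : l ∈ W.free ↔ W l = none := by simp [free]
    simp only [Finset.mem_sdiff, h1, h2]
    rcases h : W' l with _ | x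
    · simp
    · rcases h' : W l with _ | y
      · simp
      · have := hs l y h'
        rw [h] at this
        simp [this]
  · rw [if_pos hl]; exact card_image_some_le
  · rw [if_neg hl]; split_ifs <;> simp

open Classical in
/-- The subtori of a given one, weighted by their density, have total weight at most `2 ^ d`. -/
theorem sum_sub_inv_pow_le (hn : 0 < n) (W : Cube d n) :
    ∑ W' ∈ Finset.univ.filter (fun W' : Cube d n => W'.Sub W),
      ((n : ℝ) ^ (W.dim - W'.dim))⁻¹ ≤ 2 ^ d := by
  have hn' : (0 : ℝ) < n := by exact_mod_cast hn
  rw [← Finset.sum_fiberwise _ (fun W' : Cube d n => W'.free)]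
  have hcard : ((2 : ℝ) ^ d) = ∑ _L : Finset (Fin d), (1 : ℝ) := by simp
  rw [hcard]
  refine Finset.sum_le_sum fun L _ => ?_
  rw [Finset.filter_filter]
  by_cases hL : L ⊆ W.free
  · have h1 : ∀ W' ∈ Finset.univ.filter (fun W' : Cube d n => W'.Sub W ∧ W'.free = L),
        ((n : ℝ) ^ (W.dim - W'.dim))⁻¹ = ((n : ℝ) ^ (W.free \ L).card)⁻¹ := by
      intro W' hW'
      rw [Finset.card_sdiff_of_subset hL, dim, dim, (Finset.mem_filter.1 hW').2.2]
    rw [Finset.sum_congr rfl h1, Finset.sum_const, nsmul_eq_mul, ← div_eq_mul_inv,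
      div_le_one (by positivity)]
    exact_mod_cast card_filter_sub_free_eq_le W L
  · rw [Finset.filter_eq_empty_iff.2, Finset.sum_empty]
    · norm_num
    · rintro W' _ ⟨h1, rfl⟩
      exact hL h1.free_subset

open Classical in
theorem sum_inv_pow_le (hn : 0 < n) :
    ∑ W : Cube d n, ((n : ℝ) ^ (d - W.dim))⁻¹ ≤ 2 ^ d := by
  have h := sum_sub_inv_pow_le hn (fun _ => none : Cube d n)
  have h1 : dim (fun _ => none : Cube d n) = d := by simp [dim, free]
  rwa [h1, Finset.filter_true_of_mem fun W _ l x hx => by simp at hx] at h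

-- `W'` is determined by its free set and the conflict set (at most `4 ^ d` choices) together with
-- its values on `W.free` and on the conflict set; elsewhere it is free or agrees with `W`.
open Classical in
theorem card_filter_near_le (hn : 0 < n) (W : Cube d n) :
    (Finset.univ.filter fun W' : Cube d n => W.Near W').card ≤ 4 ^ d * n ^ (W.dim + 2) := by
  let T : Finset (Finset (Fin d) × Finset (Fin d)) := Finset.univ.filter fun t => t.2.card ≤ 2
  have hsub : (Finset.univ.filter fun W' : Cube d n => W.Near W') ⊆
      T.biUnion fun t => Fintype.piFinset fun l : Fin d =>
        if l ∈ t.1 then {none} else if l ∈ W.free ∪ t.2 then Finset.univ.image some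
          else {W l} := by
    intro W' hW'
    refine Finset.mem_biUnion.2 ⟨(W'.free, conflict W W'), ?_, Fintype.mem_piFinset.2 fun l => ?_⟩
    · exact Finset.mem_filter.2 ⟨Finset.mem_univ _, (Finset.mem_filter.1 hW').2⟩
    · rcases h' : W' l with _ | x
      · simp [free, h']
      · rcases h : W l with _ | y
        · simp [free, h, h']
        · by_cases hxy : y = x
          · simp [free, h, h', hxy, conflict]
          · simp [free, h, h', hxy, conflict]
  refine (Finset.card_le_card hsub).trans ((Finset.card_biUnion_le_card_mul _ _
    (n ^ (W.dim + 2)) fun t ht => ?_).trans (Nat.mul_le_mul_right _ ?_))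
  · refine (card_piFinset_le _ (W.free ∪ t.2) (fun l hl => ?_) fun l hl => ?_).trans
      (Nat.pow_le_pow_right hn ((Finset.card_union_le _ _).trans
        (Nat.add_le_add_left (Finset.mem_filter.1 ht).2 _)))
    · split_ifs
      · rw [Finset.card_singleton]; exact hn
      · exact card_image_some_le
    · split_ifs <;> simp
  · refine (Finset.card_le_univ T).trans (le_of_eq ?_)
    rw [Fintype.card_prod, Fintype.card_finset, Fintype.card_fin, ← mul_pow]
    norm_num

end Cube

open Classical in
/-- The expected number of open sets that are assembled into `W`, if every vertex is open with
probability `x`. -/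
noncomputable def assemblyWeight (x : ℝ) (W : Cube d n) : ℝ :=
  ∑ B ∈ Finset.univ.filter (fun B => Assembles B W), x ^ B.card

theorem assemblyWeight_nonneg {x : ℝ} (hx : 0 ≤ x) (W : Cube d n) : 0 ≤ assemblyWeight x W :=
  Finset.sum_nonneg fun _ _ => pow_nonneg hx _

theorem sum_pow_card_le_sum_assemblyWeight {x : ℝ} (hx : 0 ≤ x)
    (F : Finset (Finset (Fin d → Fin n))) (S : Finset (Cube d n))
    (h : ∀ B ∈ F, ∃ W ∈ S, Assembles B W) :
    ∑ B ∈ F, x ^ B.card ≤ ∑ W ∈ S, assemblyWeight x W := by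
  classical
  simp only [assemblyWeight]
  rw [Finset.sum_sigma']
  set Y := S.sigma fun W : Cube d n => Finset.univ.filter fun B => Assembles B W
  calc ∑ B ∈ F, x ^ B.card
      ≤ ∑ B ∈ Y.image fun t => t.2, x ^ B.card := by
        refine Finset.sum_le_sum_of_subset_of_nonneg (fun B hB => ?_)
          fun _ _ _ => pow_nonneg hx _
        obtain ⟨W, hW, hBW⟩ := h B hB
        exact Finset.mem_image.2 ⟨⟨W, B⟩, by simp [Y, hW, hBW], rfl⟩
    _ ≤ ∑ t ∈ Y, x ^ t.2.card := Finset.sum_image_le_of_nonneg fun _ _ => pow_nonneg hx _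

/-- Disjointness makes `x ^ (B₁ ∪ B₂).card` factor, so this plays the role of a disjoint-occurrence
inequality. -/
theorem sum_pow_card_le_sum_assemblyWeight_mul {x : ℝ} (hx : 0 ≤ x)
    (F : Finset (Finset (Fin d → Fin n))) (S : Finset (Cube d n × Cube d n))
    (h : ∀ B ∈ F, ∃ P ∈ S, ∃ B₁ B₂, Assembles B₁ P.1 ∧ Assembles B₂ P.2 ∧ Disjoint B₁ B₂ ∧
      B₁ ∪ B₂ = B) :
    ∑ B ∈ F, x ^ B.card ≤ ∑ P ∈ S, assemblyWeight x P.1 * assemblyWeight x P.2 := by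
  classical
  let Y : Finset ((_ : Cube d n × Cube d n) ×
      (Finset (Fin d → Fin n) × Finset (Fin d → Fin n))) :=
    S.sigma fun P => (Finset.univ.filter fun B => Assembles B P.1) ×ˢ
      Finset.univ.filter fun B => Assembles B P.2
  have hY : ∑ P ∈ S, assemblyWeight x P.1 * assemblyWeight x P.2 =
      ∑ t ∈ Y, x ^ t.2.1.card * x ^ t.2.2.card := by
    rw [Finset.sum_sigma]
    refine Finset.sum_congr rfl fun P _ => ?_
    rw [assemblyWeight, assemblyWeight, Finset.sum_mul_sum, Finset.sum_product]
  rw [hY]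
  calc ∑ B ∈ F, x ^ B.card
      ≤ ∑ B ∈ (Y.filter fun t => Disjoint t.2.1 t.2.2).image fun t => t.2.1 ∪ t.2.2,
          x ^ B.card := by
        refine Finset.sum_le_sum_of_subset_of_nonneg (fun B hB => ?_)
          fun _ _ _ => pow_nonneg hx _
        obtain ⟨P, hP, B₁, B₂, h₁, h₂, hd, rfl⟩ := h B hB
        exact Finset.mem_image.2 ⟨⟨P, B₁, B₂⟩, by simp [Y, hP, h₁, h₂, hd], rfl⟩
    _ ≤ ∑ t ∈ Y.filter fun t => Disjoint t.2.1 t.2.2, x ^ (t.2.1 ∪ t.2.2).card :=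
        Finset.sum_image_le_of_nonneg fun _ _ => pow_nonneg hx _
    _ = ∑ t ∈ Y.filter fun t => Disjoint t.2.1 t.2.2, x ^ t.2.1.card * x ^ t.2.2.card :=
        Finset.sum_congr rfl fun t ht => by
          rw [Finset.card_union_of_disjoint (Finset.mem_filter.1 ht).2, pow_add]
    _ ≤ _ := Finset.sum_le_sum_of_subset_of_nonneg (Finset.filter_subset _ _)
        fun _ _ _ => by positivity

end Counting

/-! ### Arithmetic of the cost exponent -/

section Exponents

/-- A lower bound for the cost exponent of internally spanning a subtorus of dimension `i`, when
vertices are open with probability of order `n ^ (-(2 * J + 2))`. -/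
noncomputable def costExponent (J i : ℕ) : ℝ := 2 * J + 2 + i * (J - 1 / 2) - (i : ℝ) ^ 2 / 4

theorem exists_le_le_add_eq {i₁ i₂ s : ℕ} (h : s ≤ i₁ + i₂) :
    ∃ j₁ j₂, j₁ ≤ i₁ ∧ j₂ ≤ i₂ ∧ j₁ + j₂ = s :=
  ⟨min i₁ s, s - min i₁ s, min_le_left _ _, by omega, by omega⟩

/-- The concave parabola `costExponent J i + i` peaks at `i = 2J + 1`; `costExponent J` itself peaks
at `2J - 1`. -/
theorem costExponent_add_mono {J i j : ℕ} (hij : i ≤ j) (hj : j ≤ 2 * J + 1) :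
    costExponent J i + i ≤ costExponent J j + j := by
  have h1 : (i : ℝ) ≤ j := by exact_mod_cast hij
  have h2 : (j : ℝ) ≤ 2 * J + 1 := by exact_mod_cast hj
  simp only [costExponent]
  nlinarith [mul_nonneg (sub_nonneg.2 h1) (show 0 ≤ (J : ℝ) + 1 / 2 - (i + j) / 4 by linarith)]

theorem costExponent_mono {J i j : ℕ} (hij : i ≤ j) (hj : j + 1 ≤ 2 * J) :
    costExponent J i ≤ costExponent J j := by
  have h1 : (i : ℝ) ≤ j := by exact_mod_cast hij
  have h2 : (j : ℝ) + 1 ≤ 2 * J := by exact_mod_cast hj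
  simp only [costExponent]
  nlinarith [mul_nonneg (sub_nonneg.2 h1) (show 0 ≤ (J : ℝ) - 1 / 2 - (i + j) / 4 by linarith)]

theorem costExponent_zero (J : ℕ) : costExponent J 0 = 2 * J + 2 := by simp [costExponent]

/-- The terms `i - i₁` and `i - i₂` pay for choosing the two parts inside the merged subtorus. For
`i ≥ 2`, monotonicity reduces to `i = j₁ + j₂ + 2`, where the slack is `j₁ * j₂ / 2`; it vanishes
when one part is a single vertex, the optimal strategy. -/
theorem costExponent_le_of_merge {J i i₁ i₂ : ℕ} (h₁ : i₁ < i) (h₂ : i₂ < i)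
    (h : i ≤ i₁ + i₂ + 2) (hi : i ≤ 2 * J + 2) :
    costExponent J i + (i - i₁) + (i - i₂) ≤ costExponent J i₁ + costExponent J i₂ := by
  rcases Nat.lt_or_ge i 2 with h0 | h0
  · obtain rfl : i = 1 := by omega
    obtain rfl : i₁ = 0 := by omega
    obtain rfl : i₂ = 0 := by omega
    have : (0 : ℝ) ≤ J := Nat.cast_nonneg J
    simp only [costExponent]
    push_cast
    linarith
  · obtain ⟨j₁, j₂, hj₁, hj₂, hj⟩ := exists_le_le_add_eq (i₁ := i₁) (i₂ := i₂) (s := i - 2)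
      (by omega)
    have e1 := costExponent_add_mono hj₁ (J := J) (by omega)
    have e2 := costExponent_add_mono hj₂ (J := J) (by omega)
    have hij : (i : ℝ) = j₁ + j₂ + 2 := by
      have : i = j₁ + j₂ + 2 := by omega
      exact_mod_cast this
    have e3 : costExponent J i + i + i ≤ costExponent J j₁ + j₁ + (costExponent J j₂ + j₂) := by
      have : (0 : ℝ) ≤ j₁ * j₂ := by positivity
      simp only [costExponent, hij]
      nlinarith
    linarith

/-- The left side is `d + 2`, the exponent of the number of pairs of near subtori, so the expected
number of first mergers reaching dimension `2J` stays bounded. -/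
theorem le_costExponent_add_of_first_merge {J i₁ i₂ : ℕ} (h₁ : i₁ < 2 * J) (h₂ : i₂ < 2 * J)
    (h : 2 * J ≤ i₁ + i₂ + 2) :
    ((J + 1) * (J + 2) : ℝ) + 2 ≤ costExponent J i₁ + costExponent J i₂ := by
  obtain ⟨j₁, j₂, hj₁, hj₂, hj⟩ := exists_le_le_add_eq (i₁ := i₁) (i₂ := i₂) (s := 2 * J - 2)
    (by omega)
  have e1 := costExponent_mono hj₁ (J := J) (by omega)
  have e2 := costExponent_mono hj₂ (J := J) (by omega)
  have hj' : (j₁ : ℝ) = 2 * J - 2 - j₂ := by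
    have : j₁ + j₂ + 2 = 2 * J := by omega
    have : (j₁ : ℝ) + j₂ + 2 = 2 * J := by exact_mod_cast this
    linarith
  have e3 : ((J + 1) * (J + 2) : ℝ) + 2 + j₁ * j₂ / 2 = costExponent J j₁ + costExponent J j₂ := by
    simp only [costExponent, hj']
    ring
  have : (0 : ℝ) ≤ j₁ * j₂ := by positivity
  linarith

end Exponents

/-! ### Upper bounds for spanning probabilities -/

section UpperBounds
variable {d n : ℕ}

theorem assemblyWeight_le_of_dim_eq_zero {x : ℝ} (hx : 0 ≤ x) {W : Cube d n} (hW : W.dim = 0) :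
    assemblyWeight x W ≤ x := by
  classical
  have hsub : (Finset.univ.filter fun B => Assembles B W) ⊆
      (Finset.univ.filter fun v : Fin d → Fin n => W = Cube.ofVertex v).image fun v => {v} := by
    intro B hB
    have hBW := (Finset.mem_filter.1 hB).2
    cases hBW with
    | single v => exact Finset.mem_image.2 ⟨v, by simp, rfl⟩
    | merge h₁ h₂ _ _ hne₁ _ =>
      have := (Cube.sub_join_left _ _).dim_lt hne₁
      omega
  refine (Finset.sum_le_sum_of_subset_of_nonneg hsub fun _ _ _ => pow_nonneg hx _).trans ?_
  refine (Finset.sum_image_le_of_nonneg fun _ _ => pow_nonneg hx _).trans ?_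
  simp only [Finset.card_singleton, pow_one, Finset.sum_const, nsmul_eq_mul]
  refine mul_le_of_le_one_left hx ?_
  have : (Finset.univ.filter fun v : Fin d → Fin n => W = Cube.ofVertex v).card ≤ 1 := by
    refine Finset.card_le_one.2 fun v hv w hw => funext fun l => Option.some_injective _ ?_
    exact congrFun ((Finset.mem_filter.1 hv).2.symm.trans (Finset.mem_filter.1 hw).2) l
  exact_mod_cast this

-- The sum runs over the two parts of the last merger. Strict growth gives the smaller dimensions,
-- and nearness gives the `+ 2`.
open Classical in
theorem assemblyWeight_le_sum {x : ℝ} (hx : 0 ≤ x) {W : Cube d n} (hW : 0 < W.dim) :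
    assemblyWeight x W ≤ ∑ P ∈ ((Finset.univ.filter fun W' : Cube d n => W'.Sub W) ×ˢ
      (Finset.univ.filter fun W' : Cube d n => W'.Sub W)).filter fun P =>
        P.1.dim < W.dim ∧ P.2.dim < W.dim ∧ W.dim ≤ P.1.dim + P.2.dim + 2,
      assemblyWeight x P.1 * assemblyWeight x P.2 := by
  refine sum_pow_card_le_sum_assemblyWeight_mul hx _ _ fun B hB => ?_
  have hBW := (Finset.mem_filter.1 hB).2
  cases hBW with
  | single v => rw [Assembles.dim_ofVertex] at hW; omega
  | @merge B₁ B₂ W₁ W₂ h₁ h₂ hd hN hne₁ hne₂ =>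
    refine ⟨(W₁, W₂), ?_, B₁, B₂, h₁, h₂, hd, rfl⟩
    have := Cube.dim_join_le W₁ W₂
    have hN' : (Cube.conflict W₁ W₂).card ≤ 2 := hN
    simp only [Finset.mem_filter, Finset.mem_product, Finset.mem_univ, true_and]
    exact ⟨⟨Cube.sub_join_left _ _, Cube.sub_join_right _ _⟩,
      (Cube.sub_join_left _ _).dim_lt hne₁, (Cube.sub_join_right _ _).dim_lt hne₂, by omega⟩

theorem rpow_neg_natCast_sub {x : ℝ} {i j : ℕ} (hij : j ≤ i) :
    x ^ (-((i : ℝ) - j)) = (x ^ (i - j))⁻¹ := by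
  rw [← Nat.cast_sub hij, Real.rpow_neg_natCast, zpow_neg, zpow_natCast]

/-- Induction on the dimension through the last merger: the number of choices of the two parts
inside `W` is absorbed by `costExponent_le_of_merge`. -/
theorem exists_assemblyWeight_le (J d : ℕ) {a : ℝ} (ha : 0 ≤ a) {k : ℕ} (hk : k ≤ 2 * J + 2) :
    ∃ C : ℝ, 0 ≤ C ∧ ∀ n : ℕ, 0 < n → ∀ W : Cube d n, W.dim ≤ k →
      assemblyWeight (a * (n : ℝ) ^ (-(2 * J + 2 : ℝ))) W ≤
        C * (n : ℝ) ^ (-costExponent J W.dim) := by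
  classical
  induction k with
  | zero =>
    refine ⟨a, ha, fun n hn W hW => ?_⟩
    have hW0 : W.dim = 0 := by omega
    rw [hW0, costExponent_zero]
    exact assemblyWeight_le_of_dim_eq_zero (by positivity) hW0
  | succ k ih =>
    obtain ⟨C, hC, hCW⟩ := ih (by omega)
    refine ⟨max C (C ^ 2 * 4 ^ d), le_max_of_le_left hC, fun n hn W hW => ?_⟩
    have hn0 : (0 : ℝ) < n := by exact_mod_cast hn
    have hn1 : (1 : ℝ) ≤ n := by exact_mod_cast hn
    have hpow : 0 ≤ (n : ℝ) ^ (-costExponent J W.dim) := by positivity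
    rcases Nat.lt_or_ge k W.dim with h | h
    swap
    · exact (hCW n hn W h).trans (mul_le_mul_of_nonneg_right (le_max_left _ _) hpow)
    refine le_trans ?_ (mul_le_mul_of_nonneg_right (le_max_right _ _) hpow)
    have hx : 0 ≤ a * (n : ℝ) ^ (-(2 * J + 2 : ℝ)) := by positivity
    set x := a * (n : ℝ) ^ (-(2 * J + 2 : ℝ))
    set A := Finset.univ.filter fun W' : Cube d n => W'.Sub W
    let g : Cube d n → ℝ := fun W' => ((n : ℝ) ^ (W.dim - W'.dim))⁻¹
    have hg : ∀ W', 0 ≤ g W' := fun W' => by positivity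
    have hgA : ∑ W' ∈ A, g W' ≤ 2 ^ d := Cube.sum_sub_inv_pow_le hn W
    refine (assemblyWeight_le_sum hx (by omega)).trans ?_
    calc _ ≤ ∑ P ∈ (A ×ˢ A).filter fun P => P.1.dim < W.dim ∧ P.2.dim < W.dim ∧
            W.dim ≤ P.1.dim + P.2.dim + 2,
            C ^ 2 * (n : ℝ) ^ (-costExponent J W.dim) * (g P.1 * g P.2) := by
          refine Finset.sum_le_sum fun P hP => ?_
          obtain ⟨-, h₁, h₂, h₃⟩ := Finset.mem_filter.1 hP
          have e1 := hCW n hn P.1 (by omega)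
          have e2 := hCW n hn P.2 (by omega)
          have e3 := costExponent_le_of_merge h₁ h₂ h₃ (J := J) (by omega)
          calc _ ≤ C * (n : ℝ) ^ (-costExponent J P.1.dim) *
                (C * (n : ℝ) ^ (-costExponent J P.2.dim)) :=
                mul_le_mul e1 e2 (assemblyWeight_nonneg hx _) (by positivity)
            _ = C ^ 2 * (n : ℝ) ^ (-costExponent J P.1.dim + -costExponent J P.2.dim) := by
                rw [Real.rpow_add hn0]; ring
            _ ≤ C ^ 2 * (n : ℝ) ^ (-costExponent J W.dim + (-((W.dim : ℝ) - P.1.dim) +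
                -((W.dim : ℝ) - P.2.dim))) := by
                refine mul_le_mul_of_nonneg_left
                  (Real.rpow_le_rpow_of_exponent_le hn1 (by linarith)) (by positivity)
            _ = _ := by
                rw [Real.rpow_add hn0, Real.rpow_add hn0, rpow_neg_natCast_sub h₁.le,
                  rpow_neg_natCast_sub h₂.le, mul_assoc]
      _ ≤ ∑ P ∈ A ×ˢ A, C ^ 2 * (n : ℝ) ^ (-costExponent J W.dim) * (g P.1 * g P.2) :=
          Finset.sum_le_sum_of_subset_of_nonneg (Finset.filter_subset _ _) fun P _ _ =>
            mul_nonneg (by positivity) (mul_nonneg (hg _) (hg _))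
      _ = C ^ 2 * (n : ℝ) ^ (-costExponent J W.dim) * ((∑ W' ∈ A, g W') * ∑ W' ∈ A, g W') := by
          rw [← Finset.mul_sum, Finset.sum_mul_sum, Finset.sum_product]
      _ ≤ C ^ 2 * (n : ℝ) ^ (-costExponent J W.dim) * (2 ^ d * 2 ^ d) :=
          mul_le_mul_of_nonneg_left (mul_le_mul hgA hgA (Finset.sum_nonneg fun _ _ => hg _)
            (by positivity)) (by positivity)
      _ = C ^ 2 * 4 ^ d * (n : ℝ) ^ (-costExponent J W.dim) := by
          rw [← mul_pow]; norm_num; ring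

-- There are `O(n ^ (2J + 2))` subtori near `V`, and one of dimension below `2J` costs at least as
-- much as a single vertex, namely `2J + 2`.
open Classical in
theorem exists_sum_near_le (J d : ℕ) {a : ℝ} (ha : 0 ≤ a) :
    ∃ C : ℝ, 0 ≤ C ∧ ∀ n : ℕ, 0 < n → ∀ V : Cube d n, V.dim = 2 * J →
      ∑ W ∈ Finset.univ.filter (fun W : Cube d n => V.Near W ∧ W.dim < 2 * J),
        assemblyWeight (a * (n : ℝ) ^ (-(2 * J + 2 : ℝ))) W ≤ C := by
  obtain ⟨C, hC, hCW⟩ := exists_assemblyWeight_le J d ha (k := 2 * J) (by omega)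
  refine ⟨4 ^ d * C, by positivity, fun n hn V hV => ?_⟩
  have hn1 : (1 : ℝ) ≤ n := by exact_mod_cast hn
  have hn0 : (0 : ℝ) < n := by exact_mod_cast hn
  calc _ ≤ ∑ W ∈ Finset.univ.filter (fun W : Cube d n => V.Near W ∧ W.dim < 2 * J),
        C * (n : ℝ) ^ (-(2 * J + 2 : ℝ)) := by
        refine Finset.sum_le_sum fun W hW => ?_
        obtain ⟨-, -, hdim⟩ := Finset.mem_filter.1 hW
        refine (hCW n hn W hdim.le).trans (mul_le_mul_of_nonneg_left
          (Real.rpow_le_rpow_of_exponent_le hn1 (neg_le_neg ?_)) hC)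
        rw [← costExponent_zero]
        exact costExponent_mono (Nat.zero_le _) hdim
    _ ≤ ∑ W ∈ Finset.univ.filter (fun W : Cube d n => V.Near W),
        C * (n : ℝ) ^ (-(2 * J + 2 : ℝ)) :=
        Finset.sum_le_sum_of_subset_of_nonneg (Finset.monotone_filter_right _ fun _ _ h => h.1)
          fun _ _ _ => by positivity
    _ ≤ (4 ^ d * (n : ℝ) ^ (2 * J + 2)) * (C * (n : ℝ) ^ (-(2 * J + 2 : ℝ))) := by
        rw [Finset.sum_const, nsmul_eq_mul]
        refine mul_le_mul_of_nonneg_right ?_ (by positivity)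
        have := Cube.card_filter_near_le hn V
        rw [hV] at this
        exact_mod_cast this
    _ = 4 ^ d * C * ((n : ℝ) ^ ((2 * J + 2 : ℕ) : ℝ) * (n : ℝ) ^ (-(2 * J + 2 : ℝ))) := by
        rw [Real.rpow_natCast]; ring
    _ = 4 ^ d * C := by
        rw [← Real.rpow_add hn0]; simp

-- There are `O(n ^ (d - i₁))` choices of a first part of dimension `i₁` and `O(n ^ (i₁ + 2))` near
-- partners, against a weight `O(n ^ (-(d + 2)))` per pair.
open Classical in
theorem exists_sum_first_merge_le {J d : ℕ} (hd : d = (J + 1) * (J + 2)) {a : ℝ} (ha : 0 ≤ a) :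
    ∃ C : ℝ, 0 ≤ C ∧ ∀ n : ℕ, 0 < n →
      ∑ P ∈ Finset.univ.filter (fun P : Cube d n × Cube d n => P.1.Near P.2 ∧ P.1.dim < 2 * J ∧
        P.2.dim < 2 * J ∧ 2 * J ≤ P.1.dim + P.2.dim + 2),
        assemblyWeight (a * (n : ℝ) ^ (-(2 * J + 2 : ℝ))) P.1 *
          assemblyWeight (a * (n : ℝ) ^ (-(2 * J + 2 : ℝ))) P.2 ≤ C := by
  obtain ⟨C, hC, hCW⟩ := exists_assemblyWeight_le J d ha (k := 2 * J) (by omega)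
  refine ⟨C ^ 2 * (4 ^ d * 2 ^ d), by positivity, fun n hn => ?_⟩
  have hn1 : (1 : ℝ) ≤ n := by exact_mod_cast hn
  have hn0 : (0 : ℝ) < n := by exact_mod_cast hn
  have hx : 0 ≤ a * (n : ℝ) ^ (-(2 * J + 2 : ℝ)) := by positivity
  calc _ ≤ ∑ P ∈ Finset.univ.filter (fun P : Cube d n × Cube d n => P.1.Near P.2 ∧
          P.1.dim < 2 * J ∧ P.2.dim < 2 * J ∧ 2 * J ≤ P.1.dim + P.2.dim + 2),
          C ^ 2 * ((n : ℝ) ^ (d + 2))⁻¹ := by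
        refine Finset.sum_le_sum fun P hP => ?_
        obtain ⟨-, -, h₁, h₂, h₃⟩ := Finset.mem_filter.1 hP
        have e3 := le_costExponent_add_of_first_merge h₁ h₂ h₃
        calc _ ≤ C * (n : ℝ) ^ (-costExponent J P.1.dim) *
              (C * (n : ℝ) ^ (-costExponent J P.2.dim)) :=
              mul_le_mul (hCW n hn _ h₁.le) (hCW n hn _ h₂.le) (assemblyWeight_nonneg hx _)
                (by positivity)
          _ = C ^ 2 * (n : ℝ) ^ (-costExponent J P.1.dim + -costExponent J P.2.dim) := by
              rw [Real.rpow_add hn0]; ring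
          _ ≤ C ^ 2 * (n : ℝ) ^ (-((d + 2 : ℕ) : ℝ)) := by
              refine mul_le_mul_of_nonneg_left
                (Real.rpow_le_rpow_of_exponent_le hn1 ?_) (by positivity)
              have hd' : (d : ℝ) = (J + 1) * (J + 2) := by exact_mod_cast hd
              push_cast
              linarith
          _ = _ := by rw [Real.rpow_neg hn0.le, Real.rpow_natCast]
    _ ≤ ∑ P ∈ Finset.univ.filter (fun P : Cube d n × Cube d n => P.1.Near P.2),
          C ^ 2 * ((n : ℝ) ^ (d + 2))⁻¹ :=
        Finset.sum_le_sum_of_subset_of_nonneg (Finset.monotone_filter_right _ fun _ _ h => h.1)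
          fun _ _ _ => by positivity
    _ = ∑ W₁ : Cube d n, ((Finset.univ.filter fun W₂ : Cube d n => W₁.Near W₂).card : ℝ) *
          (C ^ 2 * ((n : ℝ) ^ (d + 2))⁻¹) := by
        rw [Finset.sum_filter, Fintype.sum_prod_type]
        refine Finset.sum_congr rfl fun W₁ _ => ?_
        rw [← Finset.sum_filter, Finset.sum_const, nsmul_eq_mul]
    _ ≤ ∑ W₁ : Cube d n, C ^ 2 * 4 ^ d * ((n : ℝ) ^ (d - W₁.dim))⁻¹ := by
        refine Finset.sum_le_sum fun W₁ _ => ?_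
        have hdim : W₁.dim ≤ d := (Finset.card_le_univ W₁.free).trans (by simp)
        have h1 : ((Finset.univ.filter fun W₂ : Cube d n => W₁.Near W₂).card : ℝ) ≤
            4 ^ d * (n : ℝ) ^ (W₁.dim + 2) := by exact_mod_cast Cube.card_filter_near_le hn W₁
        have h2 : (n : ℝ) ^ (d + 2) = (n : ℝ) ^ (W₁.dim + 2) * (n : ℝ) ^ (d - W₁.dim) := by
          rw [← pow_add]; congr 1; omega
        calc _ ≤ 4 ^ d * (n : ℝ) ^ (W₁.dim + 2) * (C ^ 2 * ((n : ℝ) ^ (d + 2))⁻¹) :=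
              mul_le_mul_of_nonneg_right h1 (by positivity)
          _ = _ := by rw [h2]; field_simp
    _ ≤ C ^ 2 * 4 ^ d * 2 ^ d := by
        rw [← Finset.mul_sum]
        exact mul_le_mul_of_nonneg_left (Cube.sum_inv_pow_le hn) (by positivity)
    _ = _ := by ring

/-! ### Blockers: open sets that could interfere with a spanned subtorus -/

open Classical in
/-- The open sets outside `V` that can enlarge `V`, or produce another subtorus of dimension at
least `k`. -/
noncomputable def blockers (V : Cube d n) (k : ℕ) : Finset (Finset (Fin d → Fin n)) :=
  Finset.univ.filter fun B => Disjoint (B : Set (Fin d → Fin n)) V.toSet ∧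
    ((∃ W : Cube d n, V.Near W ∧ W.dim < k ∧ Assembles B W) ∨
      ∃ W₁ W₂ : Cube d n, (W₁.Near W₂ ∧ W₁.dim < k ∧ W₂.dim < k ∧ k ≤ W₁.dim + W₂.dim + 2) ∧
        ∃ B₁ B₂, Assembles B₁ W₁ ∧ Assembles B₂ W₂ ∧ Disjoint B₁ B₂ ∧ B₁ ∪ B₂ = B)

theorem nonempty_of_mem_blockers {V : Cube d n} {k : ℕ} {B : Finset (Fin d → Fin n)}
    (h : B ∈ blockers V k) : B.Nonempty := by
  classical
  obtain ⟨-, -, ⟨W, -, -, hB⟩ | ⟨_, _, -, B₁, B₂, hB, -, -, rfl⟩⟩ := Finset.mem_filter.1 h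
  · exact hB.nonempty
  · exact hB.nonempty.mono Finset.subset_union_left

theorem exists_sum_blockers_le {J d : ℕ} (hd : d = (J + 1) * (J + 2)) {a : ℝ} (ha : 0 ≤ a) :
    ∃ C : ℝ, 0 ≤ C ∧ ∀ n : ℕ, 0 < n → ∀ V : Cube d n, V.dim = 2 * J →
      ∑ B ∈ blockers V (2 * J), (a * (n : ℝ) ^ (-(2 * J + 2 : ℝ))) ^ B.card ≤ C := by
  classical
  obtain ⟨C₁, hC₁, h₁⟩ := exists_sum_near_le J d ha
  obtain ⟨C₂, hC₂, h₂⟩ := exists_sum_first_merge_le hd ha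
  refine ⟨C₁ + C₂, by positivity, fun n hn V hV => ?_⟩
  have hx : 0 ≤ a * (n : ℝ) ^ (-(2 * J + 2 : ℝ)) := by positivity
  refine le_trans ?_ (add_le_add (h₁ n hn V hV) (h₂ n hn))
  refine le_trans ?_ (add_le_add
    (sum_pow_card_le_sum_assemblyWeight hx (Finset.univ.filter fun B =>
      ∃ W : Cube d n, V.Near W ∧ W.dim < 2 * J ∧ Assembles B W) _ fun B hB => ?_)
    (sum_pow_card_le_sum_assemblyWeight_mul hx (Finset.univ.filter fun B =>
      ∃ W₁ W₂ : Cube d n, (W₁.Near W₂ ∧ W₁.dim < 2 * J ∧ W₂.dim < 2 * J ∧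
        2 * J ≤ W₁.dim + W₂.dim + 2) ∧
        ∃ B₁ B₂, Assembles B₁ W₁ ∧ Assembles B₂ W₂ ∧ Disjoint B₁ B₂ ∧ B₁ ∪ B₂ = B) _
      fun B hB => ?_))
  · rw [← Finset.sum_union_inter]
    refine le_trans (Finset.sum_le_sum_of_subset_of_nonneg (fun B hB => ?_)
      fun _ _ _ => pow_nonneg hx _) (le_add_of_nonneg_right
        (Finset.sum_nonneg fun _ _ => pow_nonneg hx _))
    rw [Finset.mem_union, Finset.mem_filter, Finset.mem_filter]
    exact (Finset.mem_filter.1 hB).2.2.imp (fun h => ⟨Finset.mem_univ _, h⟩)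
      fun h => ⟨Finset.mem_univ _, h⟩
  · obtain ⟨-, W, hN, hW, hB⟩ := Finset.mem_filter.1 hB
    exact ⟨W, Finset.mem_filter.2 ⟨Finset.mem_univ _, hN, hW⟩, hB⟩
  · obtain ⟨-, W₁, W₂, hW, hB⟩ := Finset.mem_filter.1 hB
    exact ⟨(W₁, W₂), Finset.mem_filter.2 ⟨Finset.mem_univ _, hW⟩, hB⟩

theorem exists_blocker_of_assembles {V : Cube d n} {k : ℕ} (hk : 0 < k)
    {B : Finset (Fin d → Fin n)} {W : Cube d n} (hB : Assembles B W)
    (hBV : Disjoint (B : Set (Fin d → Fin n)) V.toSet) (hW : k ≤ W.dim ∨ V.Near W) :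
    ∃ B' ∈ blockers V k, B' ⊆ B := by
  classical
  rcases Nat.lt_or_ge W.dim k with h | h
  · exact ⟨B, Finset.mem_filter.2 ⟨Finset.mem_univ _, hBV, Or.inl
      ⟨W, hW.resolve_left (by omega), h, hB⟩⟩, subset_rfl⟩
  · obtain ⟨B₁, B₂, W₁, W₂, h₁, h₂, hdis, hN, hd₁, hd₂, hj, hsub⟩ := hB.exists_first_merge hk h
    have := Cube.dim_join_le W₁ W₂
    have hN' : (Cube.conflict W₁ W₂).card ≤ 2 := hN
    exact ⟨B₁ ∪ B₂, Finset.mem_filter.2 ⟨Finset.mem_univ _,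
      hBV.mono_left (by exact_mod_cast hsub), Or.inr ⟨W₁, W₂, ⟨hN, hd₁, hd₂, by omega⟩,
        B₁, B₂, h₁, h₂, hdis, rfl⟩⟩, hsub⟩

/-- Without blockers, the open vertices outside `V` are covered by pairwise far subtori of dimension
below `k` that are also far from `V`. Together with `V` they cover a stable set, and a spanned
subtorus must lie in one member, of dimension at most `k`. -/
theorem notMem_eventI_of_forall_blockers (hn : 2 ≤ n) {V : Cube d n} {k j : ℕ} (hk : 0 < k)
    (hV : V.dim = k) (hj : k < j) {ω : Set (Fin d → Fin n)}
    (hω : ∀ B ∈ blockers V k, ¬ (B : Set (Fin d → Fin n)) ⊆ ω) : ω ∉ eventI d n j := by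
  classical
  rintro ⟨_, hT, hspan⟩
  obtain ⟨T, hTdim, rfl⟩ := Cube.exists_of_isSubtorus hT
  obtain ⟨C, h1, h2, h3⟩ := exists_assembles_cover (ω \ V.toSet).toFinset
  have hblock : ∀ c ∈ C, c.2.dim < k ∧ ¬ V.Near c.2 := by
    intro c hc
    by_contra hcon
    have hsub : (c.1 : Set (Fin d → Fin n)) ⊆ ω \ V.toSet := fun v hv => by
      simpa using (h1 c hc).2 hv
    obtain ⟨B, hB, hBc⟩ := exists_blocker_of_assembles (V := V) hk (h1 c hc).1
      (Set.disjoint_of_subset_left hsub Set.disjoint_sdiff_left) (by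
        by_contra hcon'
        push Not at hcon'
        exact hcon hcon')
    exact hω B hB fun v hv => (hsub (hBc hv)).1
  have hfar : ∀ W ∈ insert V (Prod.snd '' (C : Set (Finset (Fin d → Fin n) × Cube d n))),
      ∀ W' ∈ insert V (Prod.snd '' (C : Set (Finset (Fin d → Fin n) × Cube d n))), W ≠ W' →
        ¬ Cube.Near W W' := by
    rintro W (rfl | ⟨c, hc, rfl⟩) W' (rfl | ⟨c', hc', rfl⟩) hne
    · exact absurd rfl hne
    · exact (hblock c' hc').2
    · exact fun h => (hblock c hc).2 h.symm
    · exact h2 c hc c' hc' fun e => hne (e ▸ rfl)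
  have hcov : T.toSet ⊆ ⋃ W ∈ insert V (Prod.snd ''
      (C : Set (Finset (Fin d → Fin n) × Cube d n))), Cube.toSet W := by
    conv_lhs => rw [hspan]
    refine bootstrapSpan_subset (Cube.isStable_biUnion hfar) fun v hv => ?_
    by_cases hvV : v ∈ V.toSet
    · exact Set.mem_biUnion (Set.mem_insert _ _) hvV
    · obtain ⟨c, hc, hvc⟩ := h3 v (by simpa using ⟨hv.1, hvV⟩)
      exact Set.mem_biUnion (Set.mem_insert_of_mem _ (Set.mem_image_of_mem _ hc)) hvc
  obtain ⟨W, hW, hTW⟩ := Cube.exists_sub_of_toSet_subset_biUnion hfar hn hcov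
  have hdim : T.dim ≤ W.dim := Finset.card_le_card hTW.free_subset
  rcases hW with rfl | ⟨c, hc, rfl⟩
  · omega
  · have := (hblock c hc).1
    omega

/-- A spanned `V'` disjoint from `V` would itself contain a blocker. This makes the events attached
to parallel subtori mutually exclusive. -/
theorem not_internallySpans_of_forall_blockers (hn : 2 ≤ n) {V V' : Cube d n} {k : ℕ} (hk : 0 < k)
    (hV' : V'.dim = k) (hVV' : Disjoint V'.toSet V.toSet) {ω : Set (Fin d → Fin n)}
    (hω : ∀ B ∈ blockers V k, ¬ (B : Set (Fin d → Fin n)) ⊆ ω) :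
    ¬ InternallySpans ω V'.toSet := by
  intro h
  obtain ⟨B, hB, hBω⟩ := exists_assembles_of_internallySpans hn h
  obtain ⟨B', hB', hsub⟩ := exists_blocker_of_assembles (V := V) hk hB
    (hVV'.mono_left (hBω.trans Set.inter_subset_right)) (Or.inl hV'.ge)
  exact hω B' hB' fun v hv => (hBω (hsub hv)).1

end UpperBounds

/-! ### Lower bounds for spanning probabilities -/

section LowerBounds
open unitInterval

/-- With `S` independent of `n`, the bound is linear in `s`, hence of the right order both when `s`
tends to zero and when it is of order one. -/
theorem div_one_add_le_one_sub_exp {s S t : ℝ} (h0 : 0 ≤ s) (hS : s ≤ S) (ht : s ≤ t) :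
    s / (1 + S) ≤ 1 - Real.exp (-t) := by
  have h1 : Real.exp (-s) * Real.exp s = 1 := by rw [← Real.exp_add]; simp
  have h2 := Real.add_one_le_exp s
  have h3 := Real.exp_pos (-s)
  have h4 : Real.exp (-t) ≤ Real.exp (-s) := Real.exp_le_exp.2 (by linarith)
  have h5 : Real.exp (-s) * (1 + s) ≤ 1 := by nlinarith
  have h6 : s / (1 + S) ≤ s / (1 + s) := by gcongr
  have h7 : s / (1 + s) ≤ 1 - Real.exp (-s) := by
    rw [div_le_iff₀ (by linarith)]
    linarith
  linarith

theorem div_one_add_le_setBernoulli_real_biUnion {V ι : Type*} [Fintype V] {p : I}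
    (s : Finset ι) {A : ι → Set V} {E : ι → Set (Set V)}
    (hE : ∀ i ∈ s, DeterminedBy (A i) (E i))
    (hA : ∀ i ∈ s, ∀ j ∈ s, i ≠ j → Disjoint (A i) (A j)) {r R : ℝ} (h0 : 0 ≤ r) (hR : r ≤ R)
    (hr : r ≤ ∑ i ∈ s, (setBernoulli Set.univ p).real (E i)) :
    r / (1 + R) ≤ (setBernoulli Set.univ p).real (⋃ i ∈ s, E i) := by
  have h := setBernoulli_real_iInter_compl_le (p := p) s hE hA
  have h2 : (⋂ i ∈ s, (E i)ᶜ) = (⋃ i ∈ s, E i)ᶜ := by simp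
  rw [h2, probReal_compl_eq_one_sub MeasurableSet.of_discrete] at h
  linarith [div_one_add_le_one_sub_exp h0 hR hr]

variable {d n : ℕ}

/-- The event that the subtorus `W` is internally spanned. -/
def spanEvent (W : Cube d n) : Set (Set (Fin d → Fin n)) := {ω | InternallySpans ω W.toSet}

theorem mem_spanEvent_iff {W : Cube d n} {ω : Set (Fin d → Fin n)} :
    ω ∈ spanEvent W ↔ W.toSet ⊆ bootstrapSpan (hammingTorus d n) 2 (ω ∩ W.toSet) :=
  ⟨fun h => h.subset, fun h => Set.Subset.antisymm h
    (bootstrapSpan_subset W.isStable_toSet Set.inter_subset_right)⟩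

theorem isUpperSet_spanEvent (W : Cube d n) : IsUpperSet (spanEvent W) := by
  intro ω ω' h hω
  rw [mem_spanEvent_iff] at hω ⊢
  exact hω.trans (bootstrapSpan_mono (Set.inter_subset_inter_left _ h))

theorem determinedBy_spanEvent (W : Cube d n) : DeterminedBy W.toSet (spanEvent W) := by
  intro ω ω' h
  have : ω ∩ W.toSet = ω' ∩ W.toSet := by
    ext v
    exact ⟨fun hv => ⟨(h v hv.2).1 hv.1, hv.2⟩, fun hv => ⟨(h v hv.2).2 hv.1, hv.2⟩⟩
  rw [mem_spanEvent_iff, mem_spanEvent_iff, this]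

theorem Cube.disjoint_toSet {W W' : Cube d n} {l : Fin d} {x y : Fin n} (hx : W l = some x)
    (hy : W' l = some y) (hxy : x ≠ y) : Disjoint W.toSet W'.toSet :=
  Set.disjoint_left.2 fun _ hv hv' => hxy ((hv l x hx).symm.trans (hv' l y hy))

theorem Cube.disjoint_toSet_of_free_eq {W W' : Cube d n} (h : W.free = W'.free) (hne : W ≠ W') :
    Disjoint W.toSet W'.toSet := by
  obtain ⟨l, hl⟩ := Function.ne_iff.1 hne
  have hfree : W l = none ↔ W' l = none := by
    have := Finset.ext_iff.1 h l
    simpa [Cube.free] using this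
  rcases hx : W l with _ | x
  · exact absurd (hx.trans (hfree.1 hx).symm) hl
  rcases hy : W' l with _ | y
  · exact absurd ((hfree.2 hy).trans hy.symm) hl
  exact Cube.disjoint_toSet hx hy fun e => hl (by rw [hx, hy, e])

open Classical in
theorem Cube.le_card_filter_mem (W : Cube d n) {M : Finset (Fin d)} (hM : M ⊆ W.free)
    (G : Finset (Fin n)) :
    n ^ (W.dim - M.card) * G.card ^ M.card ≤
      (Finset.univ.filter fun v : Fin d → Fin n => v ∈ W.toSet ∧ ∀ k ∈ M, v k ∈ G).card := by
  have hprod : n ^ (W.dim - M.card) * G.card ^ M.card =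
      ∏ k : Fin d, (if k ∈ W.free \ M then n else 1) * (if k ∈ M then G.card else 1) := by
    rw [Finset.prod_mul_distrib, Finset.prod_ite, Finset.prod_ite]
    simp only [Finset.prod_const, one_pow, mul_one, Finset.filter_univ_mem]
    rw [Finset.card_sdiff_of_subset hM, Cube.dim]
  refine le_trans ?_ (Finset.card_le_card (s := Fintype.piFinset fun k : Fin d =>
    if k ∈ M then G else (W k).elim Finset.univ singleton) fun v hv => ?_)
  · rw [hprod, Fintype.card_piFinset]
    refine Finset.prod_le_prod' fun k _ => ?_
    by_cases hk : k ∈ M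
    · simp [hk]
    · rcases h : W k with _ | x <;> simp [hk, h, Cube.free]
  · rw [Fintype.mem_piFinset] at hv
    refine Finset.mem_filter.2 ⟨Finset.mem_univ _, fun k x hx => ?_, fun k hk => ?_⟩
    · have hk : k ∉ M := fun hk => by simpa [Cube.free, hx] using hM hk
      have := hv k
      rw [if_neg hk, hx] at this
      simpa using this
    · have := hv k
      rwa [if_pos hk] at this

open Classical in
theorem Cube.card_filter_free_eq (L : Finset (Fin d)) :
    (Finset.univ.filter fun W : Cube d n => W.free = L).card = n ^ (d - L.card) := by
  have h : (Finset.univ.filter fun W : Cube d n => W.free = L) =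
      Fintype.piFinset fun l : Fin d => if l ∈ L then {none} else Finset.univ.image some := by
    ext W
    rw [Finset.mem_filter, Fintype.mem_piFinset, Finset.ext_iff]
    simp only [Finset.mem_univ, true_and, Cube.free, Finset.mem_filter]
    refine forall_congr' fun l => ?_
    rcases hW : W l with _ | x <;> by_cases hl : l ∈ L <;> simp [hl]
  rw [h, Fintype.card_piFinset]
  have h2 : ∀ l : Fin d, (if l ∈ L then {none} else (Finset.univ : Finset (Fin n)).image some).card =
      if l ∈ L then 1 else n := by
    intro l
    split_ifs
    · simp
    · rw [Finset.card_image_of_injective _ (Option.some_injective _), Finset.card_univ,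
        Fintype.card_fin]
  simp only [h2]
  rw [Finset.prod_ite]
  simp only [Finset.prod_const_one, one_mul, Finset.prod_const]
  congr 1
  rw [← Finset.compl_filter, Finset.filter_univ_mem, Finset.card_compl, Fintype.card_fin]

theorem le_spanEvent_real_of_dim_eq_zero (hn : 0 < n) {p : I} {W : Cube d n} (hW : W.dim = 0) :
    (p : ℝ) ≤ (setBernoulli Set.univ p).real (spanEvent W) := by
  obtain ⟨v, hv⟩ := W.toSet_nonempty hn
  have h := setBernoulli_real_superset (p := p) ({v} : Finset (Fin d → Fin n))
  rw [Finset.card_singleton, pow_one] at h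
  rw [← h]
  refine measureReal_mono fun ω hω => mem_spanEvent_iff.2 fun w hw => ?_
  have hvw : w = v := by
    funext l
    have hl : W l ≠ none := by
      have := Finset.card_eq_zero.1 hW
      intro h
      have hmem : l ∈ W.free := by simp [Cube.free, h]
      rw [this] at hmem
      simp at hmem
    obtain ⟨x, hx⟩ := Option.ne_none_iff_exists'.1 hl
    rw [hw l x hx, hv l x hx]
  rw [hvw]
  exact subset_bootstrapSpan _ ⟨hω (by simp), hv⟩

open Classical in
/-- A subtorus is internally spanned if a parallel subtorus of codimension two in it is internally
spanned and there is an open vertex at distance two. -/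
theorem mul_le_spanEvent_real (hn : 2 ≤ n) {p : I} {W : Cube d n} {l m : Fin d} (hlm : l ≠ m)
    (hl : W l = none) (hm : W m = none) {q r₁ r₂ R₁ R₂ : ℝ} (hq : 0 ≤ q)
    (h : ∀ W' : Cube d n, W'.dim + 2 = W.dim →
      q ≤ (setBernoulli Set.univ p).real (spanEvent W'))
    (hr₁0 : 0 ≤ r₁) (hr₁ : r₁ ≤ (n : ℝ) ^ 2 / 16 * q) (hR₁ : r₁ ≤ R₁) (hr₂0 : 0 ≤ r₂)
    (hr₂ : r₂ ≤ (n : ℝ) ^ W.dim / 16 * p) (hR₂ : r₂ ≤ R₂) :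
    r₁ / (1 + R₁) * (r₂ / (1 + R₂)) ≤ (setBernoulli Set.univ p).real (spanEvent W) := by
  -- The smaller subtorus takes its coordinates `l`, `m` in `Lo` and the extra vertex in `Hi`, so
  -- they always differ in both. Each half has at least `n / 4` elements, whence the factors `1 /
  -- 16`.
  let Lo : Finset (Fin n) := Finset.univ.filter fun x => (x : ℕ) < n / 2
  let Hi : Finset (Fin n) := Finset.univ.filter fun x => ¬ (x : ℕ) < n / 2
  have hLo : Lo.card = n / 2 := by
    have : Lo = Finset.Iio (⟨n / 2, by omega⟩ : Fin n) := by
      ext x; simp [Lo, Fin.lt_def]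
    rw [this, Fin.card_Iio]
  have hHi : n / 2 + Hi.card = n := by
    rw [← hLo, Finset.card_filter_add_card_filter_not]
    simp
  have hLo' : (n : ℝ) / 4 ≤ Lo.card := by
    have : n ≤ 4 * Lo.card := by omega
    have : (n : ℝ) ≤ 4 * Lo.card := by exact_mod_cast this
    linarith
  have hHi' : (n : ℝ) / 4 ≤ Hi.card := by
    have : n ≤ 4 * Hi.card := by omega
    have : (n : ℝ) ≤ 4 * Hi.card := by exact_mod_cast this
    linarith
  have hn0 : (0 : ℝ) < n := by exact_mod_cast (by omega : 0 < n)
  let sub : Fin n × Fin n → Cube d n := fun t =>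
    Function.update (Function.update W l (some t.1)) m (some t.2)
  have hsubl : ∀ t, sub t l = some t.1 := fun t => by simp [sub, hlm]
  have hsubm : ∀ t, sub t m = some t.2 := fun t => by simp [sub]
  have hsubW : ∀ t, (sub t).Sub W := fun t k x hx => by
    have hkl : k ≠ l := by rintro rfl; simp [hl] at hx
    have hkm : k ≠ m := by rintro rfl; simp [hm] at hx
    simp [sub, hkl, hkm, hx]
  have hlmW : {l, m} ⊆ W.free := by
    intro k hk
    rcases Finset.mem_insert.1 hk with rfl | hk
    · simp [Cube.free, hl]
    · rw [Finset.mem_singleton.1 hk]; simp [Cube.free, hm]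
  have hcard2 : ({l, m} : Finset (Fin d)).card = 2 := Finset.card_pair hlm
  have hdimW : 2 ≤ W.dim := hcard2 ▸ Finset.card_le_card hlmW
  have hsubdim : ∀ t, (sub t).dim + 2 = W.dim := fun t => by
    have : (sub t).free = W.free \ {l, m} := by
      ext k
      by_cases hkl : k = l
      · subst hkl; simp [Cube.free, hsubl]
      by_cases hkm : k = m
      · subst hkm; simp [Cube.free, hsubm]
      simp [Cube.free, sub, hkl, hkm]
    rw [Cube.dim, this, Finset.card_sdiff_of_subset hlmW, hcard2]
    exact Nat.sub_add_cancel hdimW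
  let U : Finset (Fin d → Fin n) :=
    Finset.univ.filter fun v => v ∈ W.toSet ∧ ∀ k ∈ ({l, m} : Finset (Fin d)), v k ∈ Hi
  let E₁ : Set (Set (Fin d → Fin n)) := ⋃ t ∈ Lo ×ˢ Lo, spanEvent (sub t)
  let E₂ : Set (Set (Fin d → Fin n)) := ⋃ v ∈ U, {ω | ({v} : Set (Fin d → Fin n)) ⊆ ω}
  have hE₁ : r₁ / (1 + R₁) ≤ (setBernoulli Set.univ p).real E₁ := by
    refine div_one_add_le_setBernoulli_real_biUnion _ (A := fun t => (sub t).toSet)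
      (fun t _ => determinedBy_spanEvent _) ?_ hr₁0 hR₁ ?_
    · intro t _ t' _ hne
      by_cases h1 : t.1 = t'.1
      · exact Cube.disjoint_toSet (hsubm t) (hsubm t') fun h2 => hne (Prod.ext h1 h2)
      · exact Cube.disjoint_toSet (hsubl t) (hsubl t') h1
    · refine hr₁.trans (le_trans ?_ (Finset.sum_le_sum fun t _ => h (sub t) (hsubdim t)))
      rw [Finset.sum_const, nsmul_eq_mul, Finset.card_product]
      refine mul_le_mul_of_nonneg_right ?_ hq
      push_cast
      nlinarith
  have hE₂ : r₂ / (1 + R₂) ≤ (setBernoulli Set.univ p).real E₂ := by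
    refine div_one_add_le_setBernoulli_real_biUnion _ (A := fun v => {v})
      (fun v _ => determinedBy_superset _) ?_ hr₂0 hR₂ ?_
    · intro v _ v' _ hne
      exact Set.disjoint_singleton.2 hne
    · have hU : (n : ℝ) ^ W.dim / 16 ≤ U.card := by
        have h1 := Cube.le_card_filter_mem W hlmW Hi
        rw [hcard2] at h1
        have h2 : (n : ℝ) ^ (W.dim - 2) * (Hi.card : ℝ) ^ 2 ≤ U.card := by exact_mod_cast h1
        refine le_trans ?_ h2
        obtain ⟨e, he⟩ := Nat.exists_eq_add_of_le' hdimW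
        rw [he, Nat.add_sub_cancel, pow_add, mul_div_assoc]
        refine mul_le_mul_of_nonneg_left ?_ (by positivity)
        nlinarith
      refine hr₂.trans ((mul_le_mul_of_nonneg_right hU p.2.1).trans (le_of_eq ?_))
      rw [← nsmul_eq_mul, ← Finset.sum_const]
      refine Finset.sum_congr rfl fun v _ => ?_
      have := setBernoulli_real_superset (p := p) ({v} : Finset (Fin d → Fin n))
      rw [Finset.card_singleton, pow_one, Finset.coe_singleton] at this
      exact this.symm
  have hup₁ : IsUpperSet E₁ := isUpperSet_iUnion₂ fun t _ => isUpperSet_spanEvent _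
  have hup₂ : IsUpperSet E₂ := isUpperSet_iUnion₂ fun v _ => fun _ _ hst hs => hs.trans hst
  refine (mul_le_mul hE₁ hE₂ (by have := hr₂0.trans hR₂; positivity) measureReal_nonneg).trans
    ((setBernoulli_harris_upper hup₁ hup₂).trans (measureReal_mono ?_))
  rintro ω ⟨h₁, h₂⟩
  simp only [E₁, E₂, Set.mem_iUnion, exists_prop] at h₁ h₂
  obtain ⟨t, ht, hω⟩ := h₁
  obtain ⟨v, hv, hvω⟩ := h₂
  rw [mem_spanEvent_iff] at hω ⊢
  have hvU := (Finset.mem_filter.1 hv).2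
  have htLo := Finset.mem_product.1 ht
  have hne : ∀ x ∈ Lo, ∀ y ∈ Hi, y ≠ x := by
    intro x hx y hy e
    exact (Finset.mem_filter.1 hy).2 (e ▸ (Finset.mem_filter.1 hx).2)
  have hWeq : Function.update (Function.update (sub t) l none) m none = W := by
    funext k
    by_cases hkm : k = m
    · subst hkm; simp [hm]
    by_cases hkl : k = l
    · subst hkl; simp [hkm, hl]
    simp [sub, hkm, hkl]
  have key := Cube.update_none_update_none_subset
    (isStable_bootstrapSpan (ω ∩ W.toSet)) (W := sub t)
    (hω.trans (bootstrapSpan_mono (Set.inter_subset_inter_right _ (hsubW t).toSet_subset)))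
    (v := v) (subset_bootstrapSpan _ ⟨hvω rfl, hvU.1⟩) hlm (hsubl t) (hsubm t)
    (hne _ htLo.1 _ (hvU.2 l (by simp))) (hne _ htLo.2 _ (hvU.2 m (by simp)))
    (by rw [hWeq]; exact hvU.1)
  rwa [hWeq] at key

/-- The `2` counts the positions of the smaller subtorus; the bracket is the exponent of `n ^ (2j +
2) * p`. -/
theorem costExponent_two_mul_succ (J j : ℕ) :
    -costExponent J (2 * (j + 1)) = 2 - costExponent J (2 * j) + (2 * j + 2 - (2 * J + 2)) := by
  simp only [costExponent]
  push_cast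
  ring

theorem exists_le_spanEvent_real {J d : ℕ} (hJ : 1 ≤ J) {a : ℝ} (ha : 0 < a) {j : ℕ}
    (hj : j ≤ J + 1) :
    ∃ c : ℝ, 0 < c ∧ ∀ n : ℕ, 2 ≤ n → ∀ p : I, (p : ℝ) = a * (n : ℝ) ^ (-(2 * J + 2 : ℝ)) →
      ∀ W : Cube d n, W.dim = 2 * j →
        c * (n : ℝ) ^ (-costExponent J (2 * j)) ≤
          (setBernoulli Set.univ p).real (spanEvent W) := by
  induction j with
  | zero =>
    refine ⟨a, ha, fun n hn p hp W hW => ?_⟩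
    rw [mul_zero, costExponent_zero, ← hp]
    exact le_spanEvent_real_of_dim_eq_zero (by omega) hW
  | succ j ih =>
    obtain ⟨c, hc, h⟩ := ih (by omega)
    refine ⟨c / 16 / (1 + c / 16) * (a / 16 / (1 + a / 16)), by positivity,
      fun n hn p hp W hW => ?_⟩
    have hn1 : (1 : ℝ) ≤ n := by exact_mod_cast (by omega : 1 ≤ n)
    have hn0 : (0 : ℝ) < n := by linarith
    obtain ⟨l, hl, m, hm, hlm⟩ := Finset.one_lt_card.1 (show 1 < W.free.card by
      rw [Cube.dim] at hW; omega)
    have hcost : 2 - costExponent J (2 * j) ≤ 0 := by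
      have h1 := costExponent_mono (Nat.zero_le 1) (J := J) (by omega)
      have h3 : (1 : ℝ) ≤ J := by exact_mod_cast hJ
      have h4 : (j : ℝ) ≤ J := by exact_mod_cast (by omega : j ≤ J)
      have h5 : (0 : ℝ) ≤ j := Nat.cast_nonneg j
      simp only [costExponent]
      push_cast
      nlinarith [mul_nonneg h5 (sub_nonneg.2 h4), mul_nonneg h5 (sub_nonneg.2 h3)]
    -- Equality holds at `j = J`: the last extension costs only a constant factor.
    have hexp₂ : (2 * j + 2 - (2 * J + 2) : ℝ) ≤ 0 := by
      have h4 : (j : ℝ) ≤ J := by exact_mod_cast (by omega : j ≤ J)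
      linarith
    have key := mul_le_spanEvent_real hn (p := p) (W := W) hlm (by simpa [Cube.free] using hl)
      (by simpa [Cube.free] using hm) (q := c * (n : ℝ) ^ (-costExponent J (2 * j)))
      (r₁ := c / 16 * (n : ℝ) ^ (2 - costExponent J (2 * j)))
      (r₂ := a / 16 * (n : ℝ) ^ (2 * j + 2 - (2 * J + 2) : ℝ)) (R₁ := c / 16) (R₂ := a / 16)
      (by positivity) (fun W' hW' => h n hn p hp W' (by omega)) (by positivity) ?_
      (mul_le_of_le_one_right (by positivity) (Real.rpow_le_one_of_one_le_of_nonpos hn1 hcost))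
      (by positivity) ?_
      (mul_le_of_le_one_right (by positivity) (Real.rpow_le_one_of_one_le_of_nonpos hn1 hexp₂))
    · refine le_trans (le_of_eq ?_) key
      rw [costExponent_two_mul_succ, Real.rpow_add hn0]
      ring
    · rw [sub_eq_add_neg, Real.rpow_add hn0]
      refine le_of_eq ?_
      norm_num
      ring
    · rw [hp, hW, sub_eq_add_neg, Real.rpow_add hn0, ← Real.rpow_natCast]
      refine le_of_eq ?_
      push_cast
      ring_nf

end LowerBounds

/-! ### The critical levels `2J` and `2J + 2`, and growth to the whole torus -/

section Main
open unitInterval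
variable {d n : ℕ}

theorem costExponent_two_mul (J : ℕ) :
    costExponent J (2 * J) = (J + 1) * (J + 2) - 2 * J := by
  simp only [costExponent]; push_cast; ring

theorem costExponent_two_mul_add_two (J : ℕ) :
    costExponent J (2 * J + 2) = (J + 1) * (J + 2) - (2 * J + 2) := by
  simp only [costExponent]; push_cast; ring

theorem spanEvent_subset_eventI (hn : 0 < n) (W : Cube d n) : spanEvent W ⊆ eventI d n W.dim :=
  fun _ h => ⟨W.toSet, W.isSubtorus_toSet hn, h⟩

theorem pow_mul_rpow_costExponent (hn : 0 < n) {i J : ℕ} (hi : i ≤ d)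
    (h : costExponent J i = d - i) : (n : ℝ) ^ (d - i) * (n : ℝ) ^ (-costExponent J i) = 1 := by
  have hn0 : (0 : ℝ) < n := by exact_mod_cast hn
  rw [h, rpow_neg_natCast_sub hi]
  exact mul_inv_cancel₀ (by positivity)

theorem exists_le_eventI_real {J d : ℕ} (hJ : 1 ≤ J) (hd : d = (J + 1) * (J + 2)) {a : ℝ}
    (ha : 0 < a) : ∃ c : ℝ, 0 < c ∧ ∀ n : ℕ, 2 ≤ n → ∀ p : I,
      (p : ℝ) = a * (n : ℝ) ^ (-(2 * J + 2 : ℝ)) →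
        c ≤ (setBernoulli Set.univ p).real (eventI d n (2 * J + 2)) := by
  classical
  obtain ⟨c, hc, h⟩ := exists_le_spanEvent_real (d := d) hJ ha (j := J + 1) le_rfl
  refine ⟨c / (1 + c), by positivity, fun n hn p hp => ?_⟩
  have hdim : 2 * (J + 1) ≤ d := by rw [hd]; nlinarith
  obtain ⟨L, -, hL⟩ := Finset.exists_subset_card_eq (s := (Finset.univ : Finset (Fin d)))
    (by simpa using hdim)
  have hW : ∀ W ∈ Finset.univ.filter (fun W : Cube d n => W.free = L), W.dim = 2 * (J + 1) := by
    intro W hW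
    rw [Cube.dim, (Finset.mem_filter.1 hW).2, hL]
  refine (div_one_add_le_setBernoulli_real_biUnion
    (Finset.univ.filter fun W : Cube d n => W.free = L) (A := fun W => W.toSet)
    (fun W _ => determinedBy_spanEvent W) ?_ hc.le le_rfl ?_).trans (measureReal_mono ?_)
  · intro W hW W' hW' hne
    exact Cube.disjoint_toSet_of_free_eq
      ((Finset.mem_filter.1 hW).2.trans (Finset.mem_filter.1 hW').2.symm) hne
  · refine le_trans (le_of_eq ?_) (Finset.sum_le_sum fun W hW' => h n hn p hp W (hW W hW'))
    rw [Finset.sum_const, nsmul_eq_mul, Cube.card_filter_free_eq, hL, mul_left_comm, Nat.cast_pow,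
      pow_mul_rpow_costExponent (by omega) hdim, mul_one]
    rw [mul_add, mul_one, costExponent_two_mul_add_two, hd]
    push_cast
    ring
  · refine Set.iUnion₂_subset fun W hW' => ?_
    have := spanEvent_subset_eventI (by omega) W
    rwa [hW W hW'] at this

/-- Over the `n ^ (d - 2J)` parallel `V`, the mutually exclusive events "`V` is spanned and has no
open blocker" each have probability at least `c * exp (-2C) * n ^ (-(d - 2J))`. -/
theorem exists_le_eventI_diff_real {J d : ℕ} (hJ : 1 ≤ J) (hd : d = (J + 1) * (J + 2)) {a : ℝ}
    (ha : 0 < a) : ∃ c : ℝ, 0 < c ∧ ∀ n : ℕ, 2 ≤ n → ∀ p : I,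
      (p : ℝ) = a * (n : ℝ) ^ (-(2 * J + 2 : ℝ)) → (p : ℝ) ≤ 1 / 2 →
        c ≤ (setBernoulli Set.univ p).real (eventI d n (2 * J) \ eventI d n (2 * J + 2)) := by
  classical
  obtain ⟨c, hc, h⟩ := exists_le_spanEvent_real (d := d) hJ ha (j := J) (by omega)
  obtain ⟨C, hC, hblock⟩ := exists_sum_blockers_le hd ha.le
  refine ⟨c * Real.exp (-(2 * C)), by positivity, fun n hn p hp hp2 => ?_⟩
  have hdim : 2 * J ≤ d := by rw [hd]; nlinarith
  obtain ⟨L, -, hL⟩ := Finset.exists_subset_card_eq (s := (Finset.univ : Finset (Fin d)))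
    (by simpa using hdim)
  have hW : ∀ W ∈ Finset.univ.filter (fun W : Cube d n => W.free = L), W.dim = 2 * J := by
    intro W hW
    rw [Cube.dim, (Finset.mem_filter.1 hW).2, hL]
  let D : Cube d n → Set (Set (Fin d → Fin n)) := fun V =>
    {ω | ∀ B ∈ blockers V (2 * J), ¬ (B : Set (Fin d → Fin n)) ⊆ ω}
  have hdisj : ∀ V ∈ Finset.univ.filter (fun W : Cube d n => W.free = L),
      ∀ V' ∈ Finset.univ.filter (fun W : Cube d n => W.free = L), V ≠ V' →
        Disjoint V.toSet V'.toSet := fun V hV V' hV' hne =>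
    Cube.disjoint_toSet_of_free_eq
      ((Finset.mem_filter.1 hV).2.trans (Finset.mem_filter.1 hV').2.symm) hne
  have hprob : ∀ V ∈ Finset.univ.filter (fun W : Cube d n => W.free = L),
      c * (n : ℝ) ^ (-costExponent J (2 * J)) * Real.exp (-(2 * C)) ≤
        (setBernoulli Set.univ p).real (spanEvent V ∩ D V) := by
    intro V hV
    have hD : DeterminedBy V.toSetᶜ (D V) := fun ω ω' hω => by
      refine forall₂_congr fun B hB => not_congr (forall₂_congr fun v hv => hω v fun hvV => ?_)
      exact Set.disjoint_left.1 (Finset.mem_filter.1 hB).2.1 hv hvV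
    rw [setBernoulli_real_inter (determinedBy_spanEvent V) hD disjoint_compl_right]
    refine mul_le_mul (h n hn p hp V (hW V hV)) (le_trans (Real.exp_le_exp.2 ?_)
      (exp_le_setBernoulli_real_forall_not_superset (blockers V (2 * J))
        (fun B hB => nonempty_of_mem_blockers hB) hp2)) (Real.exp_pos _).le measureReal_nonneg
    have := hblock n (by omega) V (hW V hV)
    rw [← hp] at this
    linarith
  calc c * Real.exp (-(2 * C))
      = ∑ V ∈ Finset.univ.filter (fun W : Cube d n => W.free = L),
          c * (n : ℝ) ^ (-costExponent J (2 * J)) * Real.exp (-(2 * C)) := by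
        rw [Finset.sum_const, nsmul_eq_mul, Cube.card_filter_free_eq, hL, Nat.cast_pow]
        have := pow_mul_rpow_costExponent (n := n) (by omega) hdim (J := J) (by
          rw [costExponent_two_mul, hd]; push_cast; ring)
        linear_combination -(c * Real.exp (-(2 * C))) * this
    _ ≤ ∑ V ∈ Finset.univ.filter (fun W : Cube d n => W.free = L),
          (setBernoulli Set.univ p).real (spanEvent V ∩ D V) := Finset.sum_le_sum hprob
    _ = (setBernoulli Set.univ p).real
          (⋃ V ∈ Finset.univ.filter (fun W : Cube d n => W.free = L), spanEvent V ∩ D V) := by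
        refine (measureReal_biUnion_finset (fun V hV V' hV' hne => ?_)
          fun _ _ => MeasurableSet.of_discrete).symm
        refine Set.disjoint_left.2 fun ω hω hω' => ?_
        exact not_internallySpans_of_forall_blockers hn (by omega) (hW V' hV')
          (hdisj V hV V' hV' hne).symm hω.2 hω'.1
    _ ≤ _ := by
        refine measureReal_mono (Set.iUnion₂_subset fun V hV ω hω => ⟨?_, ?_⟩)
        · have := spanEvent_subset_eventI (by omega) V hω.1
          rwa [hW V hV] at this
        · exact notMem_eventI_of_forall_blockers hn (by omega) (hW V hV) (by omega) hω.2

theorem spanEvent_real_le {p : I} (hn : 2 ≤ n) (W : Cube d n) :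
    (setBernoulli Set.univ p).real (spanEvent W) ≤ assemblyWeight (p : ℝ) W := by
  classical
  refine (measureReal_mono (s₂ := ⋃ B ∈ Finset.univ.filter (fun B => Assembles B W),
    {ω : Set (Fin d → Fin n) | (B : Set (Fin d → Fin n)) ⊆ ω}) (fun ω hω => ?_)
      (measure_ne_top _ _)).trans
      ((measureReal_biUnion_finset_le _ _).trans (le_of_eq ?_))
  · obtain ⟨B, hB, hBω⟩ := exists_assembles_of_internallySpans hn hω
    exact Set.mem_biUnion (Finset.mem_filter.2 ⟨Finset.mem_univ _, hB⟩)
      fun v hv => (hBω hv).1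
  · exact Finset.sum_congr rfl fun B _ => setBernoulli_real_superset B

/-- The event that no open vertex allows to extend `W` in direction `l`. -/
def noExtension (W : Cube d n) (l : Fin d) : Set (Set (Fin d → Fin n)) :=
  {ω | ∀ v ∈ Cube.toSet (Function.update W l none : Cube d n), v ∉ W.toSet → v ∉ ω}

theorem determinedBy_noExtension (W : Cube d n) (l : Fin d) :
    DeterminedBy W.toSetᶜ (noExtension W l) := fun _ _ h =>
  forall₂_congr fun v _ => forall_congr' fun hv => not_congr (h v hv)

/-- An open vertex at distance one in every fixed direction would let `W` grow to the whole torus.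
-/
theorem spanEvent_diff_eventI_subset (hn : 0 < n) (W : Cube d n) :
    spanEvent W \ eventI d n d ⊆
      ⋃ l ∈ W.freeᶜ, spanEvent W ∩ noExtension W l := by
  rintro ω ⟨hω, hd⟩
  by_contra hcon
  simp only [Set.mem_iUnion, not_exists] at hcon
  refine hd ⟨Set.univ, ⟨∅, ?_⟩, ?_⟩
  · exact ⟨fun _ => ⟨0, hn⟩, by simp, by simp⟩
  · rw [InternallySpans, Set.inter_univ]
    have hWω : W.toSet ⊆ bootstrapSpan (hammingTorus d n) 2 ω :=
      (mem_spanEvent_iff.1 hω).trans (bootstrapSpan_mono Set.inter_subset_left)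
    refine (IsStable.univ_subset_of_forall_exists (isStable_bootstrapSpan ω) hWω
      fun l x₀ hl => ?_).symm
    have h1 : ω ∉ noExtension W l := fun h => hcon l (by simp [Cube.free, hl]) ⟨hω, h⟩
    simp only [noExtension, Set.mem_ofPred_eq, not_forall, not_not] at h1
    obtain ⟨v, hv, hvW, hvω⟩ := h1
    refine ⟨v, subset_bootstrapSpan _ hvω, fun hvl => hvW fun k x hx => ?_, hv⟩
    by_cases hk : k = l
    · subst hk
      rw [hl] at hx
      rw [hvl, Option.some_injective _ hx]
    · exact hv k x (by rwa [Function.update_of_ne hk])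

/-- The `n ^ W.dim * (n - 1)` vertices off `W` in direction `l` must all be closed. -/
theorem noExtension_real_le {p : I} {W : Cube d n} {l : Fin d} {x₀ : Fin n} (hl : W l = some x₀) :
    (setBernoulli Set.univ p).real (noExtension W l) ≤
      Real.exp (-((n : ℝ) ^ W.dim * (n - 1 : ℕ) * p)) := by
  classical
  let U : Cube d n := Function.update W l none
  have hUfree : U.free = insert l W.free := by
    ext k
    by_cases hk : k = l
    · subst hk; simp [Cube.free, U]
    · simp [Cube.free, U, hk]
  have hlW : l ∉ W.free := by simp [Cube.free, hl]
  have hUdim : U.dim = W.dim + 1 := by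
    rw [Cube.dim, hUfree, Finset.card_insert_of_notMem hlW, Cube.dim]
  let A : Finset (Fin d → Fin n) := Finset.univ.filter fun v =>
    v ∈ U.toSet ∧ ∀ k ∈ ({l} : Finset (Fin d)), v k ∈ (Finset.univ.erase x₀ : Finset (Fin n))
  have hA : n ^ W.dim * (n - 1) ≤ A.card := by
    have := Cube.le_card_filter_mem U (M := {l}) (by rw [hUfree]; simp)
      (Finset.univ.erase x₀ : Finset (Fin n))
    rwa [Finset.card_singleton, hUdim, Nat.add_sub_cancel, pow_one,
      Finset.card_erase_of_mem (Finset.mem_univ x₀), Finset.card_univ, Fintype.card_fin] at this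
  have key := setBernoulli_real_iInter_compl_le (p := p) A (A := fun v => {v})
    (E := fun v => {ω : Set (Fin d → Fin n) | ({v} : Set (Fin d → Fin n)) ⊆ ω})
    (fun v _ => determinedBy_superset _) (fun v _ v' _ hne => Set.disjoint_singleton.2 hne)
  refine (measureReal_mono fun ω hω => ?_).trans (key.trans (Real.exp_le_exp.2 (neg_le_neg ?_)))
  · simp only [Set.mem_iInter]
    intro v hv hvω
    obtain ⟨-, hvU, hvl⟩ := Finset.mem_filter.1 hv
    refine hω v hvU (fun hvW => ?_) (hvω rfl)
    exact (Finset.mem_erase.1 (hvl l (by simp))).1 (hvW l x₀ hl)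
  · have h1 : ∀ v ∈ A, (setBernoulli Set.univ p).real
        {ω : Set (Fin d → Fin n) | ({v} : Set (Fin d → Fin n)) ⊆ ω} = p := fun v _ => by
      have := setBernoulli_real_superset (p := p) ({v} : Finset (Fin d → Fin n))
      rwa [Finset.card_singleton, pow_one, Finset.coe_singleton] at this
    rw [Finset.sum_congr rfl h1, Finset.sum_const, nsmul_eq_mul]
    exact mul_le_mul_of_nonneg_right (by exact_mod_cast hA) p.2.1

/-- Spanning `W` and failing to extend it depend on disjoint sets of vertices. The spanning
probabilities have bounded sum, and each failure has probability at most `exp (-a * (n - 1))`. -/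
theorem exists_eventI_diff_real_le {J d : ℕ} (hd : d = (J + 1) * (J + 2)) {a : ℝ}
    (ha : 0 < a) : ∃ C : ℝ, ∀ n : ℕ, 2 ≤ n → ∀ p : I,
      (p : ℝ) = a * (n : ℝ) ^ (-(2 * J + 2 : ℝ)) →
        (setBernoulli Set.univ p).real (eventI d n (2 * J + 2) \ eventI d n d) ≤
          C * Real.exp (-(a * (n - 1 : ℕ))) := by
  classical
  obtain ⟨C, hC, h⟩ := exists_assemblyWeight_le J d ha.le (k := 2 * J + 2) le_rfl
  refine ⟨2 ^ d * C * d, fun n hn p hp => ?_⟩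
  have hn0 : (0 : ℝ) < n := by exact_mod_cast (by omega : 0 < n)
  have hdim : 2 * J + 2 ≤ d := by rw [hd]; nlinarith
  set T := Finset.univ.filter fun W : Cube d n => W.dim = 2 * J + 2
  have hexp : (n : ℝ) ^ (2 * J + 2) * (n - 1 : ℕ) * p = a * (n - 1 : ℕ) := by
    have : (n : ℝ) ^ (2 * J + 2) * (n : ℝ) ^ (-(2 * J + 2 : ℝ)) = 1 := by
      rw [← Real.rpow_natCast, ← Real.rpow_add hn0]
      simp
    rw [hp]
    linear_combination a * (n - 1 : ℕ) * this
  have hinv : (n : ℝ) ^ (-costExponent J (2 * J + 2)) = ((n : ℝ) ^ (d - (2 * J + 2)))⁻¹ := by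
    have := pow_mul_rpow_costExponent (n := n) (by omega) hdim (J := J) (by
      rw [costExponent_two_mul_add_two, hd]; push_cast; ring)
    rw [eq_inv_of_mul_eq_one_right this]
  have hT : ∀ W ∈ T, (setBernoulli Set.univ p).real (spanEvent W \ eventI d n d) ≤
      C * ((n : ℝ) ^ (d - W.dim))⁻¹ * (d * Real.exp (-(a * (n - 1 : ℕ)))) := by
    intro W hW
    have hWd : W.dim = 2 * J + 2 := (Finset.mem_filter.1 hW).2
    calc _ ≤ ∑ l ∈ W.freeᶜ, (setBernoulli Set.univ p).real (spanEvent W ∩ noExtension W l) :=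
          (measureReal_mono (spanEvent_diff_eventI_subset (by omega) W) (measure_ne_top _ _)).trans
            (measureReal_biUnion_finset_le _ _)
      _ ≤ ∑ l ∈ W.freeᶜ, C * ((n : ℝ) ^ (d - W.dim))⁻¹ * Real.exp (-(a * (n - 1 : ℕ))) := by
          refine Finset.sum_le_sum fun l hl => ?_
          have hl' : W l ≠ none := by simpa [Cube.free] using hl
          obtain ⟨x₀, hx₀⟩ := Option.ne_none_iff_exists'.1 hl'
          rw [setBernoulli_real_inter (determinedBy_spanEvent W) (determinedBy_noExtension W l)
            disjoint_compl_right]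
          refine mul_le_mul ((spanEvent_real_le hn W).trans ?_)
            ((noExtension_real_le hx₀).trans_eq ?_) measureReal_nonneg (by positivity)
          · rw [hp, hWd, ← hinv, ← hWd]
            exact h n (by omega) W hWd.le
          · rw [hWd, hexp]
      _ ≤ _ := by
          rw [Finset.sum_const, nsmul_eq_mul, mul_left_comm]
          refine mul_le_mul_of_nonneg_left (mul_le_mul_of_nonneg_right ?_ (Real.exp_pos _).le)
            (by positivity)
          exact_mod_cast (Finset.card_le_univ _).trans (by simp)
  have hcover : eventI d n (2 * J + 2) \ eventI d n d ⊆ ⋃ W ∈ T, spanEvent W \ eventI d n d := by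
    rintro ω ⟨⟨V, hV, hω⟩, hω'⟩
    obtain ⟨W, hW, rfl⟩ := Cube.exists_of_isSubtorus hV
    exact Set.mem_biUnion (show W ∈ (T : Set (Cube d n)) by simpa [T] using hW) ⟨hω, hω'⟩
  calc _ ≤ ∑ W ∈ T, (setBernoulli Set.univ p).real (spanEvent W \ eventI d n d) :=
        (measureReal_mono hcover (measure_ne_top _ _)).trans (measureReal_biUnion_finset_le _ _)
    _ ≤ ∑ W ∈ T, C * ((n : ℝ) ^ (d - W.dim))⁻¹ * (d * Real.exp (-(a * (n - 1 : ℕ)))) :=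
        Finset.sum_le_sum hT
    _ ≤ ∑ W : Cube d n, C * ((n : ℝ) ^ (d - W.dim))⁻¹ * (d * Real.exp (-(a * (n - 1 : ℕ)))) :=
        Finset.sum_le_sum_of_subset_of_nonneg (Finset.filter_subset _ _)
          fun _ _ _ => by positivity
    _ = C * (d * Real.exp (-(a * (n - 1 : ℕ)))) * ∑ W : Cube d n, ((n : ℝ) ^ (d - W.dim))⁻¹ := by
        rw [Finset.mul_sum]
        exact Finset.sum_congr rfl fun _ _ => by ring
    _ ≤ C * (d * Real.exp (-(a * (n - 1 : ℕ)))) * 2 ^ d :=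
        mul_le_mul_of_nonneg_left (Cube.sum_inv_pow_le (by omega)) (by positivity)
    _ = _ := by ring

theorem lambdaParam_pos {J d : ℕ} (h : 2 * J ≤ d) {a : ℝ} (ha : 0 < a) :
    0 < lambdaParam J d a := by
  have : 0 < d.choose (2 * J) := Nat.choose_pos h
  rw [lambdaParam]
  positivity

end Main

theorem mainTheorem4 (J : ℕ) (hJ : 1 ≤ J) (d : ℕ) (hd : d = (J + 1) * (J + 2))
    (a : ℝ) (ha : 0 < a) (p : ℕ → ℝ) (hp : ∀ n : ℕ, p n = a * (n : ℝ) ^ (-2 * (J : ℤ) - 2)) :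
    (∃ c₁ c₂ : ℝ, 0 < c₁ ∧ c₁ < c₂ ∧ c₂ < 1 - Real.exp (-lambdaParam J d a) ∧
      ∀ᶠ n : ℕ in atTop,
        c₁ < (initialLaw d n (p n)).real (eventI d n (2 * J) \ eventI d n (2 * J + 2)) ∧
        c₂ < (initialLaw d n (p n)).real (eventI d n (2 * J + 2))) ∧
    Tendsto (fun n : ℕ => (initialLaw d n (p n)).real (eventI d n (2 * J + 2) \ eventI d n d))
      atTop (𝓝 0) := by
  have hp' : ∀ n : ℕ, p n = a * (n : ℝ) ^ (-(2 * J + 2 : ℝ)) := fun n => by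
    rw [hp, ← Real.rpow_intCast]
    push_cast
    congr 2
    ring
  have hlim : Tendsto p atTop (𝓝 0) := by
    rw [funext hp', ← mul_zero a]
    exact ((tendsto_rpow_neg_atTop (by positivity)).comp tendsto_natCast_atTop_atTop).const_mul a
  have hhalf : ∀ᶠ n in atTop, p n ≤ 1 / 2 := hlim.eventually_le_const (by norm_num)
  have hproj : ∀ n, p n ≤ 1 / 2 → (Set.projIcc (0 : ℝ) 1 zero_le_one (p n) : ℝ) = p n := by
    intro n hn
    have h0 : 0 ≤ p n := by rw [hp']; positivity
    rw [Set.projIcc_of_mem zero_le_one ⟨h0, by linarith⟩]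
  constructor
  · obtain ⟨b₁, hb₁, h₁⟩ := exists_le_eventI_diff_real hJ hd ha
    obtain ⟨b₂, hb₂, h₂⟩ := exists_le_eventI_real hJ hd ha
    have hlam : 0 < 1 - Real.exp (-lambdaParam J d a) := by
      have := lambdaParam_pos (J := J) (d := d) (by rw [hd]; nlinarith) ha
      have : Real.exp (-lambdaParam J d a) < 1 := by
        rw [← Real.exp_zero]; exact Real.exp_lt_exp.2 (by linarith)
      linarith
    set L := 1 - Real.exp (-lambdaParam J d a)
    have hm : 0 < min b₂ L := lt_min hb₂ hlam
    have hm' : 0 < min b₁ (min b₂ L) := lt_min hb₁ hm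
    -- Both constants are only lower bounds, so they may be shrunk to obtain `c₁ < c₂ < L`;
    -- `lambdaParam` matters only through its positivity.
    refine ⟨min b₁ (min b₂ L) / 4, min b₂ L / 2, by positivity, ?_, ?_, ?_⟩
    · linarith [min_le_right b₁ (min b₂ L)]
    · linarith [min_le_right b₂ L]
    · filter_upwards [hhalf, eventually_ge_atTop 2] with n hn hn2
      have e1 := h₁ n hn2 _ ((hproj n hn).trans (hp' n)) ((hproj n hn).trans_le hn)
      have e2 := h₂ n hn2 _ ((hproj n hn).trans (hp' n))
      exact ⟨lt_of_lt_of_le (by linarith [min_le_left b₁ (min b₂ L)]) e1,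
        lt_of_lt_of_le (by linarith [min_le_left b₂ L]) e2⟩
  · obtain ⟨C, h⟩ := exists_eventI_diff_real_le hd ha
    have hexp : Tendsto (fun n : ℕ => C * Real.exp (-(a * (n - 1 : ℕ)))) atTop (𝓝 0) := by
      rw [← mul_zero C]
      refine (Real.tendsto_exp_neg_atTop_nhds_zero.comp ?_).const_mul C
      exact (tendsto_natCast_atTop_atTop.comp (tendsto_sub_atTop_nat 1)).const_mul_atTop ha
    refine squeeze_zero' (Eventually.of_forall fun n => measureReal_nonneg) ?_ hexp
    filter_upwards [hhalf, eventually_ge_atTop 2] with n hn hn2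
    exact h n hn2 _ ((hproj n hn).trans (hp' n))
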